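/- There are universal constants $C_1,C_2,C_3>0$ such that the following holds. Setting. Let $n\ge 2$, and let $\theta^\star\in\mathbb{R}^n$ satisfy $\theta^\star_1\ge\cdots\ge\theta^\star_n$ and $\sum_i\theta^\star_i=0$. Put $\kappa=e^{\theta^\star_1}/e^{\theta^\star_n}$. Let $\mathcal{G}=([n],\mathcal{E})$ be a (fixed) comparison graph. For every edge $(i,j)\in\mathcal{E}$ with $i>j$ we observe $L$ outcomes $y_{ij}^{(1)},\dots,y_{ij}^{(L)}\in\{0,1\}$. All outcomes are independent, with $\mathbb{P}(y_{ij}^{(l)}=1)=e^{\theta^\star_j}/(e^{\theta^\star_i}+e^{\theta^\star_j})$; write $y_{ji}^{(l)}=1-y_{ij}^{(l)}$. Let $w=\{w_{ij}\}$ be symmetric nonnegative weights supported on $\mathcal{E}$, possibly random but independent of the family of observed outcomes. Let $$w_{\max}=\max_{i,j}w_{ij},\quad d_{\max}=\max_i\sum_{j\ne i}w_{ij},\quad d_{\min}=\min_i\sum_{j\ne i}w_{ij},\quad \boldsymbol{L}_w=\sum_{i>j}w_{ij}(e_i-e_j)(e_i-e_j)^\top,$$ and let $\lambda_{n-1}(\boldsymbol{L}_w)$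 be the second smallest eigenvalue of $\boldsymbol{L}_w$, counted with multiplicity. The weighted MLE $\widehat\theta$ is the minimizer, over all $\theta\in\mathbb{R}^n$ with $\sum_i\theta_i=0$, of $$\mathcal{L}_w(\theta)=-\frac1L\sum_{i>j}\sum_{l=1}^{L}w_{ij}\log\Bigl(y_{ji}^{(l)}\frac{e^{\theta_i}}{e^{\theta_i}+e^{\theta_j}}+(1-y_{ji}^{(l)})\frac{e^{\theta_j}}{e^{\theta_i}+e^{\theta_j}}\Bigr).$$ Claim. Suppose that (almost surely) the graph formed by the edges of non-zero weight is connected, $w_{\max}\le n^2$, $d_{\min}\ge 1$, and $$L\ \ge\ C_1\,\frac{\kappa^4\,w_{\max}\,d_{\max}^4\,\log^2 n}{\lambda_{n-1}(\boldsymbol{L}_w)^5}.$$ Then there is an event of probability at least $1-n^{-10}$ on which the weighted MLE $\widehat\theta$ exists, is unique, and satisfies $$\|\widehat\theta-\theta^\star\|_\infty\ \le\ C_2\,\kappa\,\sqrt{\frac{w_{\max}\log n}{\lambda_{n-1}(\boldsymbol{L}_w)\,L}}.$$ Moreover, on the same event, for every $1\le K<n$ such that $\Delta_K:=\theta^\star_K-\theta^\star_{K+1}>0$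 and $$L\ \ge\ C_3\,\frac{\kappa^2\,w_{\max}\log n}{\lambda_{n-1}(\boldsymbol{L}_w)\,\Delta_K^2},$$ the top-$K$ items are recovered exactly: $\{1,\dots,K\}$ is the only set of $K$ items that can be selected as the $K$ largest entries of $\widehat\theta$. -/

import Mathlib

open MeasureTheory ProbabilityTheory

/-- `κ = exp θ₁ / exp θₙ` for scores listed in decreasing order. -/
noncomputable def condNumber {n : ℕ} (hn : 2 ≤ n) (θ : Fin n → ℝ) : ℝ :=
  Real.exp (θ ⟨0, by omega⟩) / Real.exp (θ ⟨n - 1, by omega⟩)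

/-- `Δ_K = θ_K - θ_{K+1}` (items numbered from `1`, hence the index shift). -/
def scoreGap {n : ℕ} (θ : Fin n → ℝ) (K : ℕ) (hK : K < n) : ℝ :=
  θ ⟨K - 1, by omega⟩ - θ ⟨K, hK⟩

/-- Nonnegative symmetric weights supported on the edges of `G`. -/
structure IsWeighting {n : ℕ} (G : SimpleGraph (Fin n)) (w : Fin n → Fin n → ℝ) : Prop where
  symm : ∀ i j, w i j = w j i
  nonneg : ∀ i j, 0 ≤ w i j
  supported : ∀ i j, ¬ G.Adj i j → w i j = 0

/-- The graph formed by the pairs of non-zero weight. -/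
def supportGraph {n : ℕ} (w : Fin n → Fin n → ℝ) : SimpleGraph (Fin n) :=
  SimpleGraph.fromRel fun i j => w i j ≠ 0

/-- The largest weight. -/
noncomputable def wMax {n : ℕ} (w : Fin n → Fin n → ℝ) : ℝ :=
  ⨆ p : Fin n × Fin n, w p.1 p.2

/-- The weighted degree of `i`. -/
def wDegree {n : ℕ} (w : Fin n → Fin n → ℝ) (i : Fin n) : ℝ :=
  ∑ j ∈ Finset.univ.filter (fun j => j ≠ i), w i j

/-- The largest weighted degree. -/
noncomputable def dMax {n : ℕ} (w : Fin n → Fin n → ℝ) : ℝ := ⨆ i, wDegree w i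

/-- The smallest weighted degree. -/
noncomputable def dMin {n : ℕ} (w : Fin n → Fin n → ℝ) : ℝ := ⨅ i, wDegree w i

/-- The vector `e_i - e_j`. -/
def edgeVec {n : ℕ} (i j : Fin n) : Fin n → ℝ := Pi.single i 1 - Pi.single j 1

/-- The weighted Laplacian `∑_{i > j} w_ij (e_i - e_j)(e_i - e_j)ᵀ`. -/
def wLaplacian {n : ℕ} (w : Fin n → Fin n → ℝ) : Matrix (Fin n) (Fin n) ℝ :=
  ∑ i, ∑ j ∈ Finset.univ.filter (fun j => j < i),
    w i j • Matrix.vecMulVec (edgeVec i j) (edgeVec i j)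

theorem wLaplacian_isHermitian {n : ℕ} (w : Fin n → Fin n → ℝ) :
    (wLaplacian w).IsHermitian := by
  ext a b
  simp [wLaplacian, Matrix.sum_apply, Matrix.vecMulVec_apply, mul_comm]

/-- `λ_{n-1}`, the second smallest eigenvalue of the weighted Laplacian: `eigenvalues₀` lists the
eigenvalues with multiplicity in decreasing order, numbered from `0`. -/
noncomputable def spectralGap {n : ℕ} (hn : 2 ≤ n) (w : Fin n → Fin n → ℝ) : ℝ :=
  (wLaplacian_isHermitian w).eigenvalues₀ ⟨n - 2, by rw [Fintype.card_fin]; omega⟩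

/-- Index of an observed comparison: an edge `(i, j)` of `G` with `i > j`, and a repetition. -/
abbrev ComparisonIdx {n : ℕ} (G : SimpleGraph (Fin n)) (L : ℕ) : Type :=
  {p : Fin n × Fin n // p.2 < p.1 ∧ G.Adj p.1 p.2} × Fin L

/-- The family of all observed outcomes, as one random element. -/
def observed {n L : ℕ} {Ω : Type*} (G : SimpleGraph (Fin n))
    (y : Fin n → Fin n → Fin L → Ω → Bool) (ω : Ω) : ComparisonIdx G L → Bool :=
  fun q => y q.1.1.1 q.1.1.2 q.2 ω

/-- Under the Bradley-Terry-Luce model with scores `θ`, on every edge `(i, j)`, `i > j`, of the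
comparison graph there are `L` outcomes; all of them are independent, and each is `true` (item `j`
beats item `i`) with probability `exp θ_j / (exp θ_i + exp θ_j)`. Nothing is required of
`y i j l` if `(i, j)` is not such an edge. -/
structure IsBTLSample {n L : ℕ} {Ω : Type*} [MeasurableSpace Ω] (μ : Measure Ω)
    (G : SimpleGraph (Fin n)) (θ : Fin n → ℝ) (y : Fin n → Fin n → Fin L → Ω → Bool) : Prop where
  measurable : ∀ i j l, j < i → G.Adj i j → Measurable (y i j l)
  prob : ∀ i j l, j < i → G.Adj i j →
    μ.real {ω | y i j l ω = true} =
      Real.exp (θ j) / (Real.exp (θ i) + Real.exp (θ j))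
  indep : iIndepFun (fun (q : ComparisonIdx G L) (ω : Ω) => observed G y ω q) μ

/-- For `i > j`, the number `y_ji = 1 - y_ij`: it is `1` if item `i` beats item `j`, and `0`
otherwise. -/
def winRev (b : Bool) : ℝ := if b = true then 0 else 1

/-- The weighted negative log-likelihood. -/
noncomputable def wLoss {n L : ℕ} (w : Fin n → Fin n → ℝ) (y : Fin n → Fin n → Fin L → Bool)
    (θ : Fin n → ℝ) : ℝ :=
  -(1 / (L : ℝ)) * ∑ i, ∑ j ∈ Finset.univ.filter (fun j => j < i), ∑ l, w i j *
    Real.log (winRev (y i j l) * (Real.exp (θ i) / (Real.exp (θ i) + Real.exp (θ j))) +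
      (1 - winRev (y i j l)) * (Real.exp (θ j) / (Real.exp (θ i) + Real.exp (θ j))))

/-- `θ` minimizes the weighted negative log-likelihood among the vectors with zero sum. -/
def IsWeightedMLE {n L : ℕ} (w : Fin n → Fin n → ℝ) (y : Fin n → Fin n → Fin L → Bool)
    (θ : Fin n → ℝ) : Prop :=
  ∑ i, θ i = 0 ∧ IsMinOn (wLoss w y) {θ' | ∑ i, θ' i = 0} θ

/-- `S` is a possible choice of `K` largest entries of `θ`. -/
def IsTopSelection {n : ℕ} (θ : Fin n → ℝ) (K : ℕ) (S : Finset (Fin n)) : Prop :=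
  S.card = K ∧ ∀ i ∈ S, ∀ j ∉ S, θ j ≤ θ i

/-- Selecting the `K` largest entries of `θ` is unambiguous and returns the first `K` items. -/
def RecoversTop {n : ℕ} (θ : Fin n → ℝ) (K : ℕ) : Prop :=
  ∀ S : Finset (Fin n), IsTopSelection θ K S ↔ S = Finset.univ.filter (fun i : Fin n => (i : ℕ) < K)

/-! Linearize the score equation at `θs`. The Hessian of the loss there is the Laplacian of `hess θs
w`, whose gap is at least λ/(4κ), and its Green function turns the score noise into a linear
estimate g (`linEst`). With the MLE written as θs + g + h, the critical equation becomes h = T h,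
where T sends the Taylor remainders of the logistic function through the same Green function.
`exists_isCritical` solves it by contraction in the sup norm, on a ball whose radius Q bounds the
sums of `greenFlow` times g². Convexity of the loss, strict along the edges of a connected support,
makes the critical point the unique MLE, and its error at k is at most |g k| + Q.

The contraction needs S * Q small, where S bounds the weighted ℓ¹ norm of the gradient of every
Green function. Two estimates give this. (1) `sum_abs_green_le`: running a lazy random walk up to
its mixing time shows that the ℓ¹ norm of the Green function exceeds its ℓ² bound 1/l by a factor of
order log n only, not √n. (2) `lintegral_exp_linEst_le`: g is a sub-Gaussian vector with proxy
4κ²W/(λL), W being the largest weight. Hence Q can come from a tail bound for the whole quadratic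
form (`measure_sum_mul_sq_gt_le`), which saves a factor log n against inserting the sup bound for g.
So S * Q has order κ⁴WD²log²n/(λ³L), with D the largest degree; the sample size makes it small,
since λ ≤ 2D.

Random weights are treated by fixing w and integrating over the product law
(`measure_prodMk_mem_le`), which is why the gap and the Green function must be measurable in w.
Top-K recovery follows because the sup error is less than half the score gap. -/

/-! ### Weighted graph Laplacians -/

namespace BTL

variable {n : ℕ}

/-- The graph Laplacian of the weights `z`, as an operator on vectors. -/
def lap (z : Fin n → Fin n → ℝ) (v : Fin n → ℝ) (i : Fin n) : ℝ :=
  ∑ j, z i j * (v i - v j)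

/-- The Dirichlet energy of `v` with respect to the weights `z`. -/
noncomputable def energy (z : Fin n → Fin n → ℝ) (v : Fin n → ℝ) : ℝ :=
  (∑ i, ∑ j, z i j * (v i - v j) ^ 2) / 2

/-- Sums over ordered pairs, grouped into unordered pairs. -/
theorem sum_sum_eq_sum_lt (f : Fin n → Fin n → ℝ) (h0 : ∀ i, f i i = 0) :
    ∑ i, ∑ j, f i j = ∑ i, ∑ j ∈ Finset.univ.filter (fun j => j < i), (f i j + f j i) := by
  have h1 : ∀ i, ∑ j, f i j = ∑ j ∈ Finset.univ.filter (fun j => j < i), f i j +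
      ∑ j ∈ Finset.univ.filter (fun j => i < j), f i j := by
    intro i
    rw [Finset.sum_filter, Finset.sum_filter, ← Finset.sum_add_distrib]
    refine Finset.sum_congr rfl fun j _ => ?_
    rcases lt_trichotomy i j with h | h | h
    · simp [h, h.le]
    · simp [h, h0]
    · simp [h, h.le]
  simp_rw [h1, Finset.sum_add_distrib]
  congr 1
  simp_rw [Finset.sum_filter]
  exact Finset.sum_comm

theorem sum_lt_eq_half (f : Fin n → Fin n → ℝ) (h0 : ∀ i, f i i = 0)
    (hs : ∀ i j, f i j = f j i) :
    ∑ i, ∑ j ∈ Finset.univ.filter (fun j => j < i), f i j = (∑ i, ∑ j, f i j) / 2 := by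
  rw [sum_sum_eq_sum_lt f h0, Finset.sum_div]
  refine Finset.sum_congr rfl fun i _ => ?_
  rw [Finset.sum_div]
  refine Finset.sum_congr rfl fun j _ => ?_
  rw [hs j i]; ring

theorem sum_mul_lap {z : Fin n → Fin n → ℝ} (hs : ∀ i j, z i j = z j i) (u v : Fin n → ℝ) :
    ∑ i, u i * lap z v i = (∑ i, ∑ j, z i j * (u i - u j) * (v i - v j)) / 2 := by
  have h1 : ∑ i, u i * lap z v i = ∑ i, ∑ j, u i * (z i j * (v i - v j)) := by
    simp_rw [lap, Finset.mul_sum]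
  have h2 : ∑ i, u i * lap z v i = ∑ i, ∑ j, u j * (z i j * (v j - v i)) := by
    rw [h1, Finset.sum_comm]
    refine Finset.sum_congr rfl fun i _ => Finset.sum_congr rfl fun j _ => ?_
    rw [hs]
  rw [eq_div_iff two_ne_zero, mul_two]
  nth_rewrite 1 [h1]
  rw [h2, ← Finset.sum_add_distrib]
  refine Finset.sum_congr rfl fun i _ => ?_
  rw [← Finset.sum_add_distrib]
  exact Finset.sum_congr rfl fun j _ => by ring

theorem sum_mul_lap_eq_sum_lt {z : Fin n → Fin n → ℝ} (hs : ∀ i j, z i j = z j i)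
    (u v : Fin n → ℝ) :
    ∑ i, u i * lap z v i =
      ∑ i, ∑ j ∈ Finset.univ.filter (fun j => j < i), z i j * (u i - u j) * (v i - v j) := by
  rw [sum_mul_lap hs, sum_lt_eq_half]
  · intro i; ring
  · intro i j; rw [hs]; ring

theorem sum_mul_lap_self {z : Fin n → Fin n → ℝ} (hs : ∀ i j, z i j = z j i) (v : Fin n → ℝ) :
    ∑ i, v i * lap z v i = energy z v := by
  rw [sum_mul_lap hs, energy]
  congr 1
  exact Finset.sum_congr rfl fun i _ => Finset.sum_congr rfl fun j _ => by ring

theorem energy_eq_sum_lt {z : Fin n → Fin n → ℝ} (hs : ∀ i j, z i j = z j i) (v : Fin n → ℝ) :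
    energy z v =
      ∑ i, ∑ j ∈ Finset.univ.filter (fun j => j < i), z i j * (v i - v j) ^ 2 := by
  rw [energy, sum_lt_eq_half]
  · intro i; ring
  · intro i j; rw [hs]; ring

theorem energy_nonneg {z : Fin n → Fin n → ℝ} (h0 : ∀ i j, 0 ≤ z i j) (v : Fin n → ℝ) :
    0 ≤ energy z v :=
  div_nonneg (Finset.sum_nonneg fun i _ => Finset.sum_nonneg fun j _ =>
    mul_nonneg (h0 i j) (sq_nonneg _)) two_pos.le

theorem energy_le_mul_energy {z z' : Fin n → Fin n → ℝ} {c : ℝ}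
    (h : ∀ i j, z i j ≤ c * z' i j) (v : Fin n → ℝ) : energy z v ≤ c * energy z' v := by
  rw [energy, energy, mul_div_assoc', Finset.mul_sum]
  refine div_le_div_of_nonneg_right (Finset.sum_le_sum fun i _ => ?_) two_pos.le
  rw [Finset.mul_sum]
  refine Finset.sum_le_sum fun j _ => ?_
  rw [← mul_assoc]
  exact mul_le_mul_of_nonneg_right (h i j) (sq_nonneg _)

theorem sum_lap {z : Fin n → Fin n → ℝ} (hs : ∀ i j, z i j = z j i) (v : Fin n → ℝ) :
    ∑ i, lap z v i = 0 := by
  have := sum_mul_lap hs (fun _ => 1) v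
  simpa using this

/-- The energy is at most the squared norm times twice the largest degree. -/
theorem energy_le_of_degree_le {z : Fin n → Fin n → ℝ} (hs : ∀ i j, z i j = z j i)
    (h0 : ∀ i j, 0 ≤ z i j) {D : ℝ} (hD : ∀ i, ∑ j, z i j ≤ D) (v : Fin n → ℝ) :
    energy z v ≤ 2 * D * ∑ i, v i ^ 2 := by
  have h1 : ∑ i, ∑ j, z i j * (v i - v j) ^ 2 ≤ ∑ i, ∑ j, (2 * (z i j * v i ^ 2) +
      2 * (z i j * v j ^ 2)) := by
    gcongr with i _ j _
    nlinarith [mul_nonneg (h0 i j) (sq_nonneg (v i + v j))]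
  have h2 : ∑ i, ∑ j, z i j * v i ^ 2 ≤ D * ∑ i, v i ^ 2 := by
    rw [Finset.mul_sum]
    gcongr with i _
    rw [← Finset.sum_mul]
    exact mul_le_mul_of_nonneg_right (hD i) (sq_nonneg _)
  have h3 : ∑ i, ∑ j, z i j * v j ^ 2 = ∑ i, ∑ j, z i j * v i ^ 2 := by
    rw [Finset.sum_comm]
    exact Finset.sum_congr rfl fun i _ => Finset.sum_congr rfl fun j _ => by rw [hs]
  simp_rw [Finset.sum_add_distrib, ← Finset.mul_sum] at h1
  rw [energy]
  linarith

/-- Cauchy–Schwarz in each row, with the weights `z i j` as the measure. -/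
theorem sum_sq_lap_le {z : Fin n → Fin n → ℝ} (h0 : ∀ i j, 0 ≤ z i j)
    {D : ℝ} (hD : ∀ i, ∑ j, z i j ≤ D) (v : Fin n → ℝ) :
    ∑ i, lap z v i ^ 2 ≤ 2 * D * energy z v := by
  have h1 : ∀ i, lap z v i ^ 2 ≤ D * ∑ j, z i j * (v i - v j) ^ 2 := by
    intro i
    have := Finset.sum_sq_le_sum_mul_sum_of_sq_le_mul Finset.univ
      (r := fun j => z i j * (v i - v j))
      (f := fun j => z i j) (g := fun j => z i j * (v i - v j) ^ 2)
      (fun j _ => h0 i j) (fun j _ => mul_nonneg (h0 i j) (sq_nonneg _))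
      (fun j _ => le_of_eq (by ring))
    refine this.trans (mul_le_mul_of_nonneg_right (hD i) ?_)
    exact Finset.sum_nonneg fun j _ => mul_nonneg (h0 i j) (sq_nonneg _)
  calc ∑ i, lap z v i ^ 2 ≤ ∑ i, D * ∑ j, z i j * (v i - v j) ^ 2 :=
        Finset.sum_le_sum fun i _ => h1 i
    _ = 2 * D * energy z v := by rw [← Finset.mul_sum, energy]; ring

/-! ### The Green function and its energy estimates -/

/-- `l` is a lower bound for the spectral gap of the Laplacian of `z`. -/
def HasGap (z : Fin n → Fin n → ℝ) (l : ℝ) : Prop :=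
  ∀ v : Fin n → ℝ, ∑ i, v i = 0 → l * ∑ i, v i ^ 2 ≤ energy z v

/-- The Laplacian of `z`, made invertible by adding the projection to the constant vectors. -/
noncomputable def lapMatrix (z : Fin n → Fin n → ℝ) : Matrix (Fin n) (Fin n) ℝ :=
  Matrix.diagonal (fun i => ∑ j, z i j) - Matrix.of z + Matrix.of fun _ _ => 1 / (n : ℝ)

/-- The Green function of the Laplacian of `z`. -/
noncomputable def green (z : Fin n → Fin n → ℝ) (k i : Fin n) : ℝ :=
  (lapMatrix z)⁻¹ i k - 1 / (n : ℝ)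

theorem lapMatrix_mulVec (z : Fin n → Fin n → ℝ) (v : Fin n → ℝ) (i : Fin n) :
    (lapMatrix z).mulVec v i = lap z v i + (∑ j, v j) / n := by
  simp only [lapMatrix, Matrix.add_mulVec, Matrix.sub_mulVec, Pi.add_apply, Pi.sub_apply,
    Matrix.mulVec_diagonal, lap, mul_sub, Finset.sum_sub_distrib]
  simp only [Matrix.mulVec, dotProduct, Matrix.of_apply, Finset.sum_mul, Finset.sum_div]
  congr 1
  exact Finset.sum_congr rfl fun j _ => by ring

theorem lapMatrix_transpose {z : Fin n → Fin n → ℝ} (hs : ∀ i j, z i j = z j i) :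
    (lapMatrix z).transpose = lapMatrix z := by
  ext i j
  simp only [lapMatrix, Matrix.transpose_apply, Matrix.add_apply, Matrix.sub_apply, Matrix.of_apply,
    Matrix.diagonal_apply, hs j i]
  by_cases h : i = j
  · subst h; simp
  · simp [h, Ne.symm h]

section Green

variable {z : Fin n → Fin n → ℝ} {l : ℝ}

/-- For a kernel vector, summing the equations kills the Laplacian part and shows that the vector
has zero sum; its energy then vanishes, and the gap makes it zero. -/
theorem isUnit_lapMatrix (hn : 0 < n) (hs : ∀ i j, z i j = z j i) (hl : 0 < l)
    (hz : HasGap z l) : IsUnit (lapMatrix z) := by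
  rw [← Matrix.mulVec_injective_iff_isUnit]
  refine (injective_iff_map_eq_zero (Matrix.mulVecLin (lapMatrix z))).2 fun v hv => ?_
  have hn' : (n : ℝ) ≠ 0 := by positivity
  have h1 : ∀ i, lap z v i + (∑ j, v j) / n = 0 := fun i => by
    rw [← lapMatrix_mulVec]; exact congrFun hv i
  have h2 : ∑ j, v j = 0 := by
    have := Finset.sum_eq_zero fun i (_ : i ∈ Finset.univ) => h1 i
    rw [Finset.sum_add_distrib, sum_lap hs] at this
    simpa [hn'] using this
  have h3 : energy z v = 0 := by
    rw [← sum_mul_lap_self hs]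
    refine Finset.sum_eq_zero fun i _ => ?_
    have := h1 i
    rw [h2] at this
    simp at this
    simp [this]
  have h4 := hz v h2
  rw [h3] at h4
  have h5 : ∑ i, v i ^ 2 = 0 :=
    le_antisymm (by nlinarith) (Finset.sum_nonneg fun i _ => sq_nonneg _)
  funext i
  have := (Finset.sum_eq_zero_iff_of_nonneg fun i _ => sq_nonneg (v i)).1 h5 i (Finset.mem_univ i)
  simpa using this

theorem sum_inv_lapMatrix (hn : 0 < n) (hs : ∀ i j, z i j = z j i) (hl : 0 < l)
    (hz : HasGap z l) (i : Fin n) : ∑ k, (lapMatrix z)⁻¹ i k = 1 := by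
  have hu := (Matrix.isUnit_iff_isUnit_det _).1 (isUnit_lapMatrix hn hs hl hz)
  have hn' : (n : ℝ) ≠ 0 := by positivity
  have h1 : (lapMatrix z).mulVec (fun _ => 1) = fun _ => 1 := by
    funext i
    rw [lapMatrix_mulVec]
    simp [lap, hn']
  have h2 := congrArg ((lapMatrix z)⁻¹.mulVec) h1
  rw [Matrix.mulVec_mulVec, Matrix.nonsing_inv_mul _ hu, Matrix.one_mulVec] at h2
  have := congrFun h2 i
  simpa [Matrix.mulVec, dotProduct] using this.symm

theorem green_comm (hs : ∀ i j, z i j = z j i) (k i : Fin n) : green z k i = green z i k := by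
  rw [green, green]
  congr 1
  have : (lapMatrix z)⁻¹.transpose = (lapMatrix z)⁻¹ := by
    rw [Matrix.transpose_nonsing_inv, lapMatrix_transpose hs]
  nth_rewrite 1 [← this]
  rfl

theorem sum_green (hn : 0 < n) (hs : ∀ i j, z i j = z j i) (hl : 0 < l)
    (hz : HasGap z l) (i : Fin n) : ∑ k, green z k i = 0 := by
  have hn' : (n : ℝ) ≠ 0 := by positivity
  simp [green, Finset.sum_sub_distrib, sum_inv_lapMatrix hn hs hl hz, hn']

theorem sum_green' (hn : 0 < n) (hs : ∀ i j, z i j = z j i) (hl : 0 < l)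
    (hz : HasGap z l) (k : Fin n) : ∑ i, green z k i = 0 := by
  simp_rw [green_comm hs k]
  exact sum_green hn hs hl hz k

theorem sum_green_mul_lap (hn : 0 < n) (hs : ∀ i j, z i j = z j i) (hl : 0 < l)
    (hz : HasGap z l) (v : Fin n → ℝ) (i : Fin n) :
    ∑ k, green z k i * lap z v k = v i - (∑ j, v j) / n := by
  have hu := (Matrix.isUnit_iff_isUnit_det _).1 (isUnit_lapMatrix hn hs hl hz)
  have h1 : ∑ k, green z k i * lap z v k = ∑ k, (lapMatrix z)⁻¹ i k * lap z v k := by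
    simp_rw [green, sub_mul, Finset.sum_sub_distrib, ← Finset.mul_sum, sum_lap hs]
    simp
  have h2 : ∀ k, lap z v k = (lapMatrix z).mulVec v k - (∑ j, v j) / n := fun k => by
    rw [lapMatrix_mulVec]; ring
  rw [h1]
  simp_rw [h2, mul_sub, Finset.sum_sub_distrib, ← Finset.sum_mul, sum_inv_lapMatrix hn hs hl hz,
    one_mul]
  congr 1
  have h3 : (lapMatrix z)⁻¹.mulVec ((lapMatrix z).mulVec v) = v := by
    rw [Matrix.mulVec_mulVec, Matrix.nonsing_inv_mul _ hu, Matrix.one_mulVec]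
  exact congrFun h3 i

theorem lap_green (hn : 0 < n) (hs : ∀ i j, z i j = z j i) (hl : 0 < l)
    (hz : HasGap z l) (k i : Fin n) :
    lap z (green z k) i = (if i = k then 1 else 0) - 1 / n := by
  have hu := (Matrix.isUnit_iff_isUnit_det _).1 (isUnit_lapMatrix hn hs hl hz)
  have hn' : (n : ℝ) ≠ 0 := by positivity
  have h1 : lap z (green z k) i = lap z (fun i => (lapMatrix z)⁻¹ i k) i := by
    simp [lap, green]
  have h2 : ∑ j, (lapMatrix z)⁻¹ j k = 1 := by
    have h := sum_green' hn hs hl hz k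
    simp only [green, Finset.sum_sub_distrib] at h
    simp [hn'] at h
    linarith
  have h3 : (lapMatrix z * (lapMatrix z)⁻¹) i k = if i = k then 1 else 0 := by
    rw [Matrix.mul_nonsing_inv _ hu, Matrix.one_apply]
  have h4 := lapMatrix_mulVec z (fun i => (lapMatrix z)⁻¹ i k) i
  rw [h2] at h4
  rw [h1, ← h3]
  rw [Matrix.mul_apply']
  simp only [Matrix.mulVec] at h4
  change _ = (lapMatrix z i ⬝ᵥ fun i => (lapMatrix z)⁻¹ i k) - 1 / (n : ℝ)
  linarith

end Green

/-- The energy is the pairing of `u` with `t`, as the constant `m` pairs to zero with `u`. Young's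
inequality with parameter `l` leaves half the energy, by the gap, to be absorbed on the left. -/
theorem energy_le_of_lap_eq {z : Fin n → Fin n → ℝ} (hs : ∀ i j, z i j = z j i) {l : ℝ}
    (hl : 0 < l) (hz : HasGap z l) {u t : Fin n → ℝ} {m : ℝ} (hu : ∑ i, u i = 0)
    (ht : ∀ i, lap z u i = t i - m) : energy z u ≤ (∑ i, t i ^ 2) / l := by
  have h1 : energy z u = ∑ i, u i * t i := by
    rw [← sum_mul_lap_self hs]
    simp_rw [ht, mul_sub, Finset.sum_sub_distrib, ← Finset.sum_mul, hu]
    simp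
  have h2 : ∑ i, u i * t i ≤ l / 2 * ∑ i, u i ^ 2 + 1 / (2 * l) * ∑ i, t i ^ 2 := by
    rw [Finset.mul_sum, Finset.mul_sum, ← Finset.sum_add_distrib]
    refine Finset.sum_le_sum fun i _ => ?_
    have : l / 2 * u i ^ 2 + 1 / (2 * l) * t i ^ 2 - u i * t i = (l * u i - t i) ^ 2 / (2 * l) := by
      field_simp; ring
    have h : 0 ≤ (l * u i - t i) ^ 2 / (2 * l) := by positivity
    linarith
  have h3 := hz u hu
  have h4 : (∑ i, t i ^ 2) / l = 2 * (1 / (2 * l) * ∑ i, t i ^ 2) := by field_simp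
  rw [h4]
  linarith

theorem sum_sq_le_of_lap_eq {z : Fin n → Fin n → ℝ} (hs : ∀ i j, z i j = z j i) {l : ℝ}
    (hl : 0 < l) (hz : HasGap z l) {u t : Fin n → ℝ} {m : ℝ} (hu : ∑ i, u i = 0)
    (ht : ∀ i, lap z u i = t i - m) : ∑ i, u i ^ 2 ≤ (∑ i, t i ^ 2) / l ^ 2 := by
  have h1 := energy_le_of_lap_eq hs hl hz hu ht
  have h2 := hz u hu
  rw [le_div_iff₀ (by positivity)]
  rw [le_div_iff₀ hl] at h1
  nlinarith

theorem sum_sq_green_le {z : Fin n → Fin n → ℝ} (hn : 0 < n) (hs : ∀ i j, z i j = z j i) {l : ℝ}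
    (hl : 0 < l) (hz : HasGap z l) (k : Fin n) : ∑ i, green z k i ^ 2 ≤ (1 / l) ^ 2 := by
  have := sum_sq_le_of_lap_eq hs hl hz (sum_green' hn hs hl hz k) (lap_green hn hs hl hz k)
  simpa using this

theorem abs_green_le {z : Fin n → Fin n → ℝ} (hn : 0 < n) (hs : ∀ i j, z i j = z j i) {l : ℝ}
    (hl : 0 < l) (hz : HasGap z l) (k i : Fin n) : |green z k i| ≤ 1 / l := by
  refine abs_le_of_sq_le_sq ?_ (by positivity)
  refine le_trans ?_ (sum_sq_green_le hn hs hl hz k)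
  exact Finset.single_le_sum (f := fun i => green z k i ^ 2) (fun i _ => sq_nonneg _)
    (Finset.mem_univ i)

end BTL

/-! ### The `ℓ¹` norm of the Green function -/

namespace BTL

variable {n : ℕ}

/-- One step of the lazy random walk with generator `lap z / D`. -/
noncomputable def walk (z : Fin n → Fin n → ℝ) (D : ℝ) (v : Fin n → ℝ) : Fin n → ℝ :=
  fun i => v i - lap z v i / D

/-- Because the walk is a polynomial in the Laplacian, ℓ¹ control of `lap z v` propagates along the
iteration. -/
theorem lap_walk (z : Fin n → Fin n → ℝ) (D : ℝ) (v : Fin n → ℝ) :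
    lap z (walk z D v) = walk z D (lap z v) := by
  funext i
  change ∑ j, z i j * ((v i - lap z v i / D) - (v j - lap z v j / D)) =
    ∑ j, z i j * (v i - v j) - (∑ j, z i j * (lap z v i - lap z v j)) / D
  rw [Finset.sum_div, ← Finset.sum_sub_distrib]
  exact Finset.sum_congr rfl fun j _ => by ring

theorem sum_walk {z : Fin n → Fin n → ℝ} (hs : ∀ i j, z i j = z j i) (D : ℝ) (v : Fin n → ℝ) :
    ∑ i, walk z D v i = ∑ i, v i := by
  simp only [walk, Finset.sum_sub_distrib, ← Finset.sum_div, sum_lap hs]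
  simp

/-- When `D` dominates the degrees, the walk matrix is symmetric with nonnegative entries and row
sums 1, hence an ℓ¹ contraction. -/
theorem sum_abs_walk_le {z : Fin n → Fin n → ℝ} (hs : ∀ i j, z i j = z j i)
    (h0 : ∀ i j, 0 ≤ z i j) {D : ℝ} (hD0 : 0 < D) (hD : ∀ i, ∑ j, z i j ≤ D) (v : Fin n → ℝ) :
    ∑ i, |walk z D v i| ≤ ∑ i, |v i| := by
  have h1 : ∀ i, |walk z D v i| ≤ (1 - (∑ j, z i j) / D) * |v i| + ∑ j, z i j / D * |v j| := by
    intro i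
    have h2 : walk z D v i = (1 - (∑ j, z i j) / D) * v i + ∑ j, z i j / D * v j := by
      simp only [walk, lap, mul_sub, Finset.sum_sub_distrib, ← Finset.sum_mul]
      have : ∑ j, z i j / D * v j = (∑ j, z i j * v j) / D := by
        rw [Finset.sum_div]; exact Finset.sum_congr rfl fun j _ => by ring
      rw [this]; ring
    have h3 : 0 ≤ 1 - (∑ j, z i j) / D := by
      rw [sub_nonneg, div_le_one hD0]; exact hD i
    rw [h2]
    refine (abs_add_le _ _).trans (add_le_add ?_ ((Finset.abs_sum_le_sum_abs _ _).trans ?_))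
    · rw [abs_mul, abs_of_nonneg h3]
    · refine Finset.sum_le_sum fun j _ => ?_
      rw [abs_mul, abs_of_nonneg (div_nonneg (h0 i j) hD0.le)]
  refine (Finset.sum_le_sum fun i _ => h1 i).trans (le_of_eq ?_)
  rw [Finset.sum_add_distrib, Finset.sum_comm (f := fun i j => z i j / D * |v j|),
    ← Finset.sum_add_distrib]
  refine Finset.sum_congr rfl fun i _ => ?_
  rw [← Finset.sum_mul, ← Finset.sum_div, Finset.sum_congr rfl fun j _ => hs j i]
  ring

/-- Laziness (degrees at most `D / 2`) lets the quadratic term consume only half of the energy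
decrease; the gap converts the other half into decay. -/
theorem sum_sq_walk_le {z : Fin n → Fin n → ℝ} (hs : ∀ i j, z i j = z j i)
    (h0 : ∀ i j, 0 ≤ z i j) {D l : ℝ} (hD0 : 0 < D) (hD : ∀ i, ∑ j, z i j ≤ D / 2)
    (hz : HasGap z l) {v : Fin n → ℝ} (hv : ∑ i, v i = 0) :
    ∑ i, walk z D v i ^ 2 ≤ (1 - l / D) * ∑ i, v i ^ 2 := by
  have h1 : ∑ i, walk z D v i ^ 2 =
      ∑ i, v i ^ 2 - 2 / D * energy z v + (∑ i, lap z v i ^ 2) / D ^ 2 := by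
    rw [← sum_mul_lap_self hs, Finset.mul_sum, Finset.sum_div, ← Finset.sum_sub_distrib,
      ← Finset.sum_add_distrib]
    refine Finset.sum_congr rfl fun i _ => ?_
    rw [walk]; field_simp; ring
  have h2 := sum_sq_lap_le h0 hD v
  have h3 : (∑ i, lap z v i ^ 2) / D ^ 2 ≤ energy z v / D := by
    rw [div_le_div_iff₀ (by positivity) hD0]
    nlinarith
  have h4 : l / D * ∑ i, v i ^ 2 ≤ energy z v / D := by
    rw [div_mul_eq_mul_div]
    exact div_le_div_of_nonneg_right (hz v hv) hD0.le
  have h5 : 2 / D * energy z v = energy z v / D + energy z v / D := by ring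
  rw [h1, h5]
  linarith

/-- Test the gap on the difference of two coordinate vectors. -/
theorem gap_le_of_degree_le {z : Fin n → Fin n → ℝ} (hn : 2 ≤ n) (hs : ∀ i j, z i j = z j i)
    (h0 : ∀ i j, 0 ≤ z i j) {D l : ℝ} (hD : ∀ i, ∑ j, z i j ≤ D) (hz : HasGap z l) :
    l ≤ 2 * D := by
  let a : Fin n := ⟨0, by omega⟩
  let b : Fin n := ⟨1, by omega⟩
  have hab : a ≠ b := by simp [a, b]
  let v : Fin n → ℝ := Pi.single a 1 - Pi.single b 1
  have h1 : ∑ i, v i = 0 := by simp [v, Finset.sum_sub_distrib]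
  have h2 : 0 < ∑ i, v i ^ 2 := by
    have : v a ^ 2 ≤ ∑ i, v i ^ 2 :=
      Finset.single_le_sum (f := fun i => v i ^ 2) (fun i _ => sq_nonneg _) (Finset.mem_univ a)
    refine lt_of_lt_of_le ?_ this
    simp [v, hab]
  have := (hz v h1).trans (energy_le_of_degree_le hs h0 hD v)
  exact le_of_mul_le_mul_right this h2

/-- Let the walk act on the Green function. Each step changes it by `lap z (a t) / D`, of ℓ¹ norm at
most 2/D, because the Laplacian of the Green function is a unit mass minus the uniform one. After
about (D/l) log n steps the ℓ² decay makes the remainder negligible. -/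
theorem sum_abs_green_le {z : Fin n → Fin n → ℝ} (hn : 2 ≤ n) (hs : ∀ i j, z i j = z j i)
    (h0 : ∀ i j, 0 ≤ z i j) {D l : ℝ} (hD0 : 0 < D) (hD : ∀ i, ∑ j, z i j ≤ D / 2)
    (hl : 0 < l) (hz : HasGap z l) (k : Fin n) :
    ∑ i, |green z k i| ≤ 7 * Real.log n / l := by
  have hn0 : 0 < n := by omega
  have hnR : (0 : ℝ) < n := by positivity
  have hlog : 0.69 ≤ Real.log n := by
    have h2 : Real.log 2 ≤ Real.log n := Real.log_le_log two_pos (by exact_mod_cast hn)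
    linarith [Real.log_two_gt_d9]
  have hlD : l ≤ D := by have := gap_le_of_degree_le hn hs h0 hD hz; linarith
  let a : ℕ → Fin n → ℝ := fun t => (walk z D)^[t] (green z k)
  have ha : ∀ t, a (t + 1) = walk z D (a t) := fun t => Function.iterate_succ_apply' _ _ _
  have hsum : ∀ t, ∑ i, a t i = 0 := by
    intro t
    induction t with
    | zero => exact sum_green' hn0 hs hl hz k
    | succ t ih => rw [ha, sum_walk hs, ih]
  have hsq : ∀ t, ∑ i, a t i ^ 2 ≤ (1 - l / D) ^ t * (1 / l) ^ 2 := by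
    intro t
    induction t with
    | zero => simpa [a] using sum_sq_green_le hn0 hs hl hz k
    | succ t ih =>
      rw [ha]
      refine (sum_sq_walk_le hs h0 hD0 hD hz (hsum t)).trans ?_
      rw [pow_succ', mul_assoc]
      refine mul_le_mul_of_nonneg_left ih ?_
      rw [sub_nonneg, div_le_one hD0]; exact hlD
  have hlap : ∀ t, ∑ i, |lap z (a t) i| ≤ 2 := by
    intro t
    induction t with
    | zero =>
      have h1 : ∀ i, |lap z (a 0) i| ≤ (if i = k then 1 else 0) + 1 / (n : ℝ) := by
        intro i
        change |lap z (green z k) i| ≤ _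
        rw [lap_green hn0 hs hl hz]
        refine (abs_sub _ _).trans (le_of_eq ?_)
        rw [abs_of_nonneg (by split_ifs <;> norm_num), abs_of_nonneg (by positivity)]
      refine (Finset.sum_le_sum fun i _ => h1 i).trans (le_of_eq ?_)
      rw [Finset.sum_add_distrib]
      simp [hnR.ne']
      norm_num
    | succ t ih =>
      rw [ha, lap_walk]
      exact (sum_abs_walk_le hs h0 hD0 (fun i => (hD i).trans (by linarith)) _).trans ih
  have hstep : ∀ t, ∑ i, |green z k i| ≤ ∑ i, |a t i| + t * (2 / D) := by
    intro t
    induction t with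
    | zero => simp [a]
    | succ t ih =>
      refine ih.trans ?_
      have h1 : ∑ i, |a t i| ≤ ∑ i, (|a (t + 1) i| + |lap z (a t) i| / D) := by
        refine Finset.sum_le_sum fun i _ => ?_
        have : a t i = a (t + 1) i + lap z (a t) i / D := by rw [ha, walk]; ring
        nth_rewrite 1 [this]
        refine (abs_add_le _ _).trans (le_of_eq ?_)
        rw [abs_div, abs_of_pos hD0]
      rw [Finset.sum_add_distrib, ← Finset.sum_div] at h1
      have h2 : (∑ i, |lap z (a t) i|) / D ≤ 2 / D := div_le_div_of_nonneg_right (hlap t) hD0.le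
      push_cast
      linarith
  -- At this time the squared ℓ² norm has lost a factor `n`, exactly what Cauchy–Schwarz costs in
  -- passing to ℓ¹.
  obtain ⟨T, hT1, hT2⟩ : ∃ T : ℕ, D / l * Real.log n ≤ T ∧ (T : ℝ) ≤ D / l * Real.log n + 1 :=
    ⟨_, Nat.le_ceil _, (Nat.ceil_lt_add_one (by positivity)).le⟩
  have hT3 : (1 - l / D) ^ T ≤ 1 / n := by
    have h1 : (1 - l / D) ^ T ≤ Real.exp (-(l / D)) ^ T := by
      refine pow_le_pow_left₀ ?_ ?_ T
      · rw [sub_nonneg, div_le_one hD0]; exact hlD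
      · have := Real.add_one_le_exp (-(l / D)); linarith
    refine h1.trans ?_
    rw [← Real.exp_nat_mul]
    have h2 : (T : ℝ) * -(l / D) ≤ - Real.log n := by
      have : Real.log n ≤ T * (l / D) := by
        calc Real.log n = D / l * Real.log n * (l / D) := by field_simp
          _ ≤ T * (l / D) := mul_le_mul_of_nonneg_right hT1 (by positivity)
      linarith
    calc Real.exp (T * -(l / D)) ≤ Real.exp (-Real.log n) := Real.exp_le_exp.2 h2
      _ = 1 / n := by rw [Real.exp_neg, Real.exp_log hnR, one_div]
  have hT4 : ∑ i, |a T i| ≤ 1 / l := by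
    refine le_of_abs_le (abs_le_of_sq_le_sq ?_ (by positivity))
    have h1 : (∑ i, |a T i|) ^ 2 ≤ n * ∑ i, a T i ^ 2 := by
      have := sq_sum_le_card_mul_sum_sq (s := Finset.univ) (f := fun i => |a T i|)
      simpa using this
    refine h1.trans ?_
    calc (n : ℝ) * ∑ i, a T i ^ 2 ≤ n * (1 / n * (1 / l) ^ 2) := by
          refine mul_le_mul_of_nonneg_left ((hsq T).trans ?_) hnR.le
          exact mul_le_mul_of_nonneg_right hT3 (by positivity)
      _ = (1 / l) ^ 2 := by field_simp
  have h5 : (T : ℝ) * (2 / D) ≤ 2 * Real.log n / l + 2 / l := by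
    calc (T : ℝ) * (2 / D) ≤ (D / l * Real.log n + 1) * (2 / D) :=
          mul_le_mul_of_nonneg_right hT2 (by positivity)
      _ = 2 * Real.log n / l + 2 / D := by field_simp
      _ ≤ _ := by gcongr
  -- The summands without logarithm total 3/l, and 3 ≤ 5 * 0.69.
  have h6 : 1 / l + (2 * Real.log n / l + 2 / l) ≤ 7 * Real.log n / l := by
    rw [← add_div, ← add_div]
    gcongr
    linarith
  linarith [hstep T]

end BTL

/-! ### Quadratic forms of sub-Gaussian vectors -/

namespace BTL

theorem lintegral_exp_mul_gaussian (a : ℝ) :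
    ∫⁻ x, ENNReal.ofReal (Real.exp (a * x)) ∂(gaussianReal 0 1) =
      ENNReal.ofReal (Real.exp (a ^ 2 / 2)) := by
  rw [← ofReal_integral_eq_lintegral_ofReal (integrable_exp_mul_gaussianReal a)
    (Filter.Eventually.of_forall fun x => (Real.exp_pos _).le)]
  congr 1
  have := congrFun (mgf_id_gaussianReal (μ := 0) (v := 1)) a
  simpa [mgf] using this

theorem one_div_one_sub_le_exp {x : ℝ} (h0 : 0 ≤ x) (h1 : x ≤ 1 / 2) :
    1 / (1 - x) ≤ Real.exp (2 * x) := by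
  rw [div_le_iff₀ (by linarith)]
  nlinarith [Real.add_one_le_exp (2 * x)]

/-- The integral equals (1 - 2a)^(-1/2), and `a ≤ 1 / 4` keeps 2a in the range of
`one_div_one_sub_le_exp`. -/
theorem lintegral_exp_mul_sq_gaussian_le {a : ℝ} (h0 : 0 ≤ a) (h1 : a ≤ 1 / 4) :
    ∫⁻ x, ENNReal.ofReal (Real.exp (a * x ^ 2)) ∂(gaussianReal 0 1) ≤
      ENNReal.ofReal (Real.exp (2 * a)) := by
  rw [gaussianReal_of_var_ne_zero _ one_ne_zero,
    lintegral_withDensity_eq_lintegral_mul _ (measurable_gaussianPDF _ _) (by fun_prop)]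
  have h2 : ∀ x : ℝ, (gaussianPDF 0 1 * fun x => ENNReal.ofReal (Real.exp (a * x ^ 2))) x =
      ENNReal.ofReal ((√(2 * Real.pi))⁻¹ * Real.exp (-(1 / 2 - a) * x ^ 2)) := by
    intro x
    rw [Pi.mul_apply, gaussianPDF, ← ENNReal.ofReal_mul (gaussianPDFReal_nonneg _ _ _),
      gaussianPDFReal]
    congr 1
    rw [mul_assoc, ← Real.exp_add]
    simp only [NNReal.coe_one, mul_one, sub_zero]
    congr 2
    ring
  simp_rw [h2]
  have hb : 0 < 1 / 2 - a := by linarith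
  rw [← ofReal_integral_eq_lintegral_ofReal ((integrable_exp_neg_mul_sq hb).const_mul _)
    (Filter.Eventually.of_forall fun x => by positivity)]
  refine ENNReal.ofReal_le_ofReal ?_
  rw [integral_const_mul, integral_gaussian, ← Real.sqrt_inv, ← Real.sqrt_mul (by positivity)]
  have h3 : (2 * Real.pi)⁻¹ * (Real.pi / (1 / 2 - a)) = 1 / (1 - 2 * a) := by
    have : 1 - 2 * a ≠ 0 := by linarith
    field_simp
  rw [h3]
  refine (Real.sqrt_le_sqrt
    (one_div_one_sub_le_exp (x := 2 * a) (by linarith) (by linarith))).trans ?_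
  rw [Real.sqrt_le_left (Real.exp_pos _).le, ← Real.exp_nat_mul]
  apply Real.exp_le_exp.2
  push_cast; linarith

theorem lintegral_pi_prod {ι : Type*} [Fintype ι] (ν : Measure ℝ) [IsProbabilityMeasure ν]
    (f : ι → ℝ → ENNReal) (hf : ∀ i, Measurable (f i)) :
    ∫⁻ z, ∏ i, f i (z i) ∂(Measure.pi fun _ : ι => ν) = ∏ i, ∫⁻ x, f i x ∂ν := by
  rw [lintegral_prod_eq_prod_lintegral_of_indepFun (μ := Measure.pi fun _ : ι => ν)
    Finset.univ (fun i (z : ι → ℝ) => f i (z i))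
    (iIndepFun_pi (X := fun i => f i) fun i => (hf i).aemeasurable)
    (fun i => (hf i).comp (measurable_pi_apply i))]
  refine Finset.prod_congr rfl fun i _ => ?_
  exact (measurePreserving_eval (fun _ : ι => ν) i).lintegral_comp (hf i)

/-- Exponential moments of a diagonal quadratic form of a sub-Gaussian vector. -/
theorem lintegral_exp_sum_mul_sq_le {ι Ω : Type*} [Fintype ι] [MeasurableSpace Ω] (μ : Measure Ω)
    [IsProbabilityMeasure μ] (g : Ω → ι → ℝ) (hg : Measurable g) {s : ℝ} (hs : 0 ≤ s)
    (hsub : ∀ t : ι → ℝ, ∫⁻ ω, ENNReal.ofReal (Real.exp (∑ i, t i * g ω i)) ∂μ ≤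
      ENNReal.ofReal (Real.exp (s * (∑ i, t i ^ 2) / 2)))
    (c : ι → ℝ) (hc : ∀ i, 0 ≤ c i) (hc' : ∀ i, 4 * (s * c i) ≤ 1) :
    ∫⁻ ω, ENNReal.ofReal (Real.exp (∑ i, c i * g ω i ^ 2)) ∂μ ≤
      ENNReal.ofReal (Real.exp (2 * s * ∑ i, c i)) := by
  have hgi : ∀ i, Measurable fun ω => g ω i := fun i => (measurable_pi_apply i).comp hg
  -- Gaussian linearization: the exponential of a square is the Gaussian average of exponentials of
  -- linear forms. After exchanging the integrals, the sub-Gaussian bound applies for each fixed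
  -- Gaussian vector.
  have h1 : ∀ ω, ENNReal.ofReal (Real.exp (∑ i, c i * g ω i ^ 2)) =
      ∫⁻ z, ENNReal.ofReal (Real.exp (∑ i, √(2 * c i) * z i * g ω i))
        ∂(Measure.pi fun _ : ι => gaussianReal 0 1) := by
    intro ω
    simp_rw [Real.exp_sum, ENNReal.ofReal_prod_of_nonneg fun i _ => (Real.exp_pos _).le]
    rw [lintegral_pi_prod (gaussianReal 0 1)
      (fun i x => ENNReal.ofReal (Real.exp (√(2 * c i) * x * g ω i))) (fun i => by fun_prop)]
    refine Finset.prod_congr rfl fun i _ => ?_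
    have := lintegral_exp_mul_gaussian (√(2 * c i) * g ω i)
    rw [mul_pow, Real.sq_sqrt (by have := hc i; positivity)] at this
    calc _ = ENNReal.ofReal (Real.exp (2 * c i * g ω i ^ 2 / 2)) := by congr 2; ring
      _ = _ := by
        rw [← this]
        exact lintegral_congr fun x => by congr 2; ring
  simp_rw [h1]
  rw [lintegral_lintegral_swap (by fun_prop)]
  have h2 : ∀ z : ι → ℝ, ∫⁻ ω, ENNReal.ofReal (Real.exp (∑ i, √(2 * c i) * z i * g ω i)) ∂μ ≤
      ∏ i, ENNReal.ofReal (Real.exp (s * c i * z i ^ 2)) := by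
    intro z
    refine (hsub fun i => √(2 * c i) * z i).trans (le_of_eq ?_)
    rw [← ENNReal.ofReal_prod_of_nonneg fun i _ => (Real.exp_pos _).le, ← Real.exp_sum,
      Finset.mul_sum, Finset.sum_div]
    congr 2
    refine Finset.sum_congr rfl fun i _ => ?_
    rw [mul_pow, Real.sq_sqrt (by have := hc i; positivity)]; ring
  refine (lintegral_mono h2).trans ?_
  rw [lintegral_pi_prod (gaussianReal 0 1)
      (fun i x => ENNReal.ofReal (Real.exp (s * c i * x ^ 2))) (fun i => by fun_prop),
    Finset.mul_sum, Real.exp_sum, ENNReal.ofReal_prod_of_nonneg fun i _ => (Real.exp_pos _).le]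
  refine Finset.prod_le_prod' fun i _ => ?_
  refine (lintegral_exp_mul_sq_gaussian_le (mul_nonneg hs (hc i)) (by linarith [hc' i])).trans ?_
  rw [mul_assoc]

end BTL

/-! ### The logistic function -/

namespace BTL

/-- The derivative of the logistic function. -/
noncomputable def dsig (x : ℝ) : ℝ := Real.sigmoid x * (1 - Real.sigmoid x)

theorem hasDerivAt_sigmoid (x : ℝ) : HasDerivAt Real.sigmoid (dsig x) x :=
  Real.hasDerivAt_sigmoid x

theorem dsig_nonneg (x : ℝ) : 0 ≤ dsig x :=
  mul_nonneg (Real.sigmoid_nonneg x) (sub_nonneg.2 (Real.sigmoid_le_one x))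

theorem dsig_le (x : ℝ) : dsig x ≤ 1 / 4 := by
  rw [dsig]; nlinarith [sq_nonneg (Real.sigmoid x - 1 / 2)]

theorem dsig_neg (x : ℝ) : dsig (-x) = dsig x := by
  rw [dsig, dsig, Real.sigmoid_neg]; ring

/-- By evenness take x ≥ 0; there the derivative is σ(x)² exp(-x) with σ(x) ≥ 1/2. -/
theorem exp_neg_div_four_le_dsig {x b : ℝ} (h : |x| ≤ b) : Real.exp (-b) / 4 ≤ dsig x := by
  wlog hx : 0 ≤ x generalizing x
  · rw [← dsig_neg]
    exact this (by rwa [abs_neg]) (by linarith)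
  rw [abs_of_nonneg hx] at h
  have h1 : dsig x = Real.sigmoid x ^ 2 * Real.exp (-x) := by
    rw [dsig, ← Real.sigmoid_neg, ← Real.sigmoid_mul_rexp_neg]; ring
  have h2 : 1 / 2 ≤ Real.sigmoid x := by
    have := Real.sigmoid_le hx
    rw [Real.sigmoid_zero] at this
    linarith
  have h3 : Real.exp (-b) ≤ Real.exp (-x) := Real.exp_le_exp.2 (by linarith)
  have h4 := Real.exp_pos (-b)
  rw [h1]
  nlinarith [mul_le_mul_of_nonneg_right (mul_self_le_mul_self (by norm_num) h2)
    (Real.exp_pos (-x)).le]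

theorem abs_sigmoid_sub_le (x y : ℝ) : |Real.sigmoid x - Real.sigmoid y| ≤ 1 / 4 * |x - y| := by
  have := convex_univ.norm_image_sub_le_of_norm_hasDerivWithin_le (f := Real.sigmoid) (f' := dsig)
    (C := 1 / 4) (x := y) (y := x) (fun t _ => (hasDerivAt_sigmoid t).hasDerivWithinAt)
    (fun t _ => by rw [Real.norm_of_nonneg (dsig_nonneg t)]; exact dsig_le t) trivial trivial
  simpa using this

theorem abs_dsig_sub_le (x y : ℝ) : |dsig x - dsig y| ≤ 1 / 4 * |x - y| := by
  have h1 : dsig x - dsig y =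
      (Real.sigmoid x - Real.sigmoid y) * (1 - Real.sigmoid x - Real.sigmoid y) := by
    rw [dsig, dsig]; ring
  have h2 : |1 - Real.sigmoid x - Real.sigmoid y| ≤ 1 := by
    rw [abs_le]
    constructor <;> linarith [Real.sigmoid_nonneg x, Real.sigmoid_nonneg y, Real.sigmoid_le_one x,
      Real.sigmoid_le_one y]
  rw [h1, abs_mul]
  calc _ ≤ |Real.sigmoid x - Real.sigmoid y| * 1 := mul_le_mul_of_nonneg_left h2 (abs_nonneg _)
    _ ≤ _ := by rw [mul_one]; exact abs_sigmoid_sub_le x y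

/-- The remainder of the first order Taylor expansion of the logistic function at `a`. -/
noncomputable def rest (a x : ℝ) : ℝ := Real.sigmoid (a + x) - Real.sigmoid a - dsig a * x

@[simp] theorem rest_zero (a : ℝ) : rest a 0 = 0 := by simp [rest]

theorem abs_rest_sub_le (a x y : ℝ) : |rest a x - rest a y| ≤ 1 / 4 * (|x| + |y|) * |x - y| := by
  have hd : ∀ t, HasDerivAt (rest a) (dsig (a + t) - dsig a) t := by
    intro t
    have h1 : HasDerivAt (fun x => Real.sigmoid (a + x)) (dsig (a + t)) t := by
      simpa using (hasDerivAt_sigmoid (a + t)).comp_const_add a t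
    have h2 : HasDerivAt (fun x => dsig a * x) (dsig a) t := by
      simpa using (hasDerivAt_id t).const_mul (dsig a)
    exact (h1.sub_const _).sub h2
  have := (convex_Icc (-(|x| + |y|)) (|x| + |y|)).norm_image_sub_le_of_norm_hasDerivWithin_le
    (f := rest a) (f' := fun t => dsig (a + t) - dsig a)
    (C := 1 / 4 * (|x| + |y|)) (x := y) (y := x) (fun t _ => (hd t).hasDerivWithinAt)
    (fun t ht => by
      refine (abs_dsig_sub_le _ _).trans ?_
      rw [add_sub_cancel_left]
      have := abs_le.2 ht
      gcongr)
    (abs_le.1 (by linarith [abs_nonneg x])) (abs_le.1 (by linarith [abs_nonneg y]))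
  simpa using this

theorem abs_rest_le (a x : ℝ) : |rest a x| ≤ 1 / 4 * x ^ 2 := by
  have := abs_rest_sub_le a x 0
  simp only [rest_zero, sub_zero, abs_zero, add_zero] at this
  rw [mul_assoc, ← pow_two, sq_abs] at this
  exact this

/-- The function `x ↦ log (1 + exp x)`, a primitive of the logistic function. -/
noncomputable def softplus (x : ℝ) : ℝ := Real.log (1 + Real.exp x)

/-- Strict convexity of `exp` between 0 and y - x, with weight σ(x) on the latter: the average of
the two values is (1 + exp y)/(1 + exp x). Take logarithms. -/
theorem softplus_add_sigmoid_mul_lt {x y : ℝ} (h : x ≠ y) :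
    softplus x + Real.sigmoid x * (y - x) < softplus y := by
  have h1 := strictConvexOn_exp.2 (Set.mem_univ (0 : ℝ)) (Set.mem_univ (y - x))
    (sub_ne_zero.2 h.symm).symm (sub_pos.2 (Real.sigmoid_lt_one x)) (Real.sigmoid_pos x) (by ring)
  simp only [smul_eq_mul, mul_zero, zero_add, Real.exp_zero, mul_one] at h1
  have hx : 0 < 1 + Real.exp x := by positivity
  have hy : 0 < 1 + Real.exp y := by positivity
  have h2 : 1 - Real.sigmoid x + Real.sigmoid x * Real.exp (y - x) =
      (1 + Real.exp y) / (1 + Real.exp x) := by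
    rw [Real.sigmoid_def, Real.exp_sub, Real.exp_neg]
    have := Real.exp_pos x
    field_simp
    ring
  rw [h2] at h1
  have h3 := (Real.lt_log_iff_exp_lt (by positivity)).2 h1
  rw [Real.log_div hy.ne' hx.ne'] at h3
  rw [softplus, softplus]
  linarith

theorem softplus_add_sigmoid_mul_le (x y : ℝ) :
    softplus x + Real.sigmoid x * (y - x) ≤ softplus y := by
  rcases eq_or_ne x y with rfl | h
  · simp
  · exact (softplus_add_sigmoid_mul_lt h).le

/-! ### Critical points of the loss are minimizers -/

variable {n L : ℕ}

/-- The empirical frequency of a win of `i` over `j`. -/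
noncomputable def winFreq (y : Fin n → Fin n → Fin L → Bool) (i j : Fin n) : ℝ :=
  (∑ l, winRev (y i j l)) / L

theorem neg_log_likelihood (b : Bool) (s t : ℝ) :
    Real.log (winRev b * (Real.exp s / (Real.exp s + Real.exp t)) +
      (1 - winRev b) * (Real.exp t / (Real.exp s + Real.exp t))) =
      -(softplus (s - t) - winRev b * (s - t)) := by
  have h1 : Real.log (Real.exp s + Real.exp t) = t + softplus (s - t) := by
    rw [softplus, ← Real.log_exp t, ← Real.log_mul (Real.exp_pos _).ne' (by positivity), mul_add,
      ← Real.exp_add, Real.log_exp]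
    congr 1
    rw [add_sub_cancel, mul_one, add_comm]
  have h2 : Real.exp s + Real.exp t ≠ 0 := by positivity
  cases b
  · simp only [winRev, Bool.false_eq_true, if_false, one_mul, sub_self, zero_mul, add_zero]
    rw [Real.log_div (Real.exp_pos _).ne' h2, h1, Real.log_exp]; ring
  · simp only [winRev, if_true, zero_mul, sub_zero, one_mul, zero_add]
    rw [Real.log_div (Real.exp_pos _).ne' h2, h1, Real.log_exp]; ring

theorem wLoss_eq (hL : 0 < L) (w : Fin n → Fin n → ℝ) (y : Fin n → Fin n → Fin L → Bool)
    (θ : Fin n → ℝ) :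
    wLoss w y θ = ∑ i, ∑ j ∈ Finset.univ.filter (fun j => j < i),
      w i j * (softplus (θ i - θ j) - winFreq y i j * (θ i - θ j)) := by
  have hL' : (L : ℝ) ≠ 0 := by positivity
  rw [wLoss, Finset.mul_sum]
  refine Finset.sum_congr rfl fun i _ => ?_
  rw [Finset.mul_sum]
  refine Finset.sum_congr rfl fun j _ => ?_
  simp_rw [neg_log_likelihood]
  rw [← Finset.mul_sum, Finset.sum_neg_distrib, Finset.sum_sub_distrib, ← Finset.sum_mul, winFreq]
  simp
  field_simp
  ring

/-- A function that agrees at the ends of every pair of non-zero weight is constant. -/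
theorem eq_of_supportGraph_connected {w : Fin n → Fin n → ℝ} (hc : (supportGraph w).Connected)
    {u : Fin n → ℝ} (hu : ∀ i j, w i j ≠ 0 → u i = u j) (i j : Fin n) : u i = u j := by
  obtain ⟨p⟩ := hc.preconnected i j
  induction p with
  | nil => rfl
  | cons h _ ih =>
    rw [← ih]
    rw [supportGraph, SimpleGraph.fromRel_adj] at h
    rcases h.2 with h | h
    · exact hu _ _ h
    · exact (hu _ _ h).symm

/-- `θ` is a critical point of the loss, in the weak form. -/
def IsCritical (w p : Fin n → Fin n → ℝ) (θ : Fin n → ℝ) : Prop :=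
  ∀ v : Fin n → ℝ, ∑ i, ∑ j ∈ Finset.univ.filter (fun j => j < i),
    w i j * (Real.sigmoid (θ i - θ j) - p i j) * (v i - v j) = 0

/-- At a critical point the first order term, tested against `θ' - θ`, vanishes; only Bregman
divergences of `softplus` remain, so minimality and uniqueness can be read off edge by edge. -/
theorem wLoss_sub_eq (hL : 0 < L) {w : Fin n → Fin n → ℝ} {y : Fin n → Fin n → Fin L → Bool}
    {θ : Fin n → ℝ} (hθ : IsCritical w (winFreq y) θ) (θ' : Fin n → ℝ) :
    wLoss w y θ' - wLoss w y θ = ∑ i, ∑ j ∈ Finset.univ.filter (fun j => j < i), w i j *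
      (softplus (θ' i - θ' j) -
        (softplus (θ i - θ j) + Real.sigmoid (θ i - θ j) * ((θ' i - θ' j) - (θ i - θ j)))) := by
  have h := hθ (θ' - θ)
  rw [wLoss_eq hL, wLoss_eq hL, ← sub_zero (_ - _), ← h]
  simp_rw [← Finset.sum_sub_distrib]
  refine Finset.sum_congr rfl fun i _ => Finset.sum_congr rfl fun j _ => ?_
  simp only [Pi.sub_apply]
  ring

theorem isWeightedMLE_of_isCritical (hL : 0 < L) {w : Fin n → Fin n → ℝ}
    (h0 : ∀ i j, 0 ≤ w i j) {y : Fin n → Fin n → Fin L → Bool} {θ : Fin n → ℝ}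
    (hs : ∑ i, θ i = 0) (hθ : IsCritical w (winFreq y) θ) : IsWeightedMLE w y θ := by
  refine ⟨hs, fun θ' _ => ?_⟩
  have h := wLoss_sub_eq hL hθ θ'
  have h1 : 0 ≤ wLoss w y θ' - wLoss w y θ := by
    rw [h]
    exact Finset.sum_nonneg fun i _ => Finset.sum_nonneg fun j _ =>
      mul_nonneg (h0 i j) (sub_nonneg.2 (softplus_add_sigmoid_mul_le _ _))
  exact sub_nonneg.1 h1

/-- Every Bregman term must vanish, so by strict convexity `θ' - θ` agrees at the ends of each
weighted edge. Connectedness makes it constant, and the zero sums make it zero. -/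
theorem eq_of_isWeightedMLE (hn : 0 < n) (hL : 0 < L) {w : Fin n → Fin n → ℝ}
    (hsymm : ∀ i j, w i j = w j i)
    (h0 : ∀ i j, 0 ≤ w i j) (hc : (supportGraph w).Connected)
    {y : Fin n → Fin n → Fin L → Bool} {θ θ' : Fin n → ℝ}
    (hs : ∑ i, θ i = 0) (hθ : IsCritical w (winFreq y) θ) (hθ' : IsWeightedMLE w y θ') :
    θ' = θ := by
  have h1 : wLoss w y θ' - wLoss w y θ ≤ 0 := sub_nonpos.2 (hθ'.2 hs)
  rw [wLoss_sub_eq hL hθ θ'] at h1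
  have hpos : ∀ i j, 0 ≤ w i j * (softplus (θ' i - θ' j) -
        (softplus (θ i - θ j) + Real.sigmoid (θ i - θ j) * ((θ' i - θ' j) - (θ i - θ j)))) :=
    fun i j => mul_nonneg (h0 i j) (sub_nonneg.2 (softplus_add_sigmoid_mul_le _ _))
  have h2 := le_antisymm h1 (Finset.sum_nonneg fun i _ => Finset.sum_nonneg fun j _ => hpos i j)
  rw [Finset.sum_eq_zero_iff_of_nonneg
    (fun i _ => Finset.sum_nonneg fun j _ => hpos i j)] at h2
  have h3 : ∀ i j, j < i → w i j ≠ 0 → θ' i - θ i = θ' j - θ j := by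
    intro i j hji hw
    have h4 := h2 i (Finset.mem_univ i)
    rw [Finset.sum_eq_zero_iff_of_nonneg (fun j _ => hpos i j)] at h4
    have h5 := h4 j (by simpa using hji)
    by_contra hne
    have h6 : θ i - θ j ≠ θ' i - θ' j := fun h => hne (by linarith)
    have h7 := softplus_add_sigmoid_mul_lt h6
    rcases mul_eq_zero.1 h5 with h8 | h8
    · exact hw h8
    · linarith
  have h4 : ∀ i j, w i j ≠ 0 → (θ' - θ) i = (θ' - θ) j := by
    intro i j hw
    rcases lt_trichotomy i j with h | h | h
    · exact (h3 j i h (by rwa [hsymm])).symm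
    · rw [h]
    · exact h3 i j h hw
  have h5 := eq_of_supportGraph_connected hc h4
  have h6 : ∑ i, (θ' - θ) i = 0 := by
    simp [Finset.sum_sub_distrib, hs, hθ'.1]
  funext k
  have h7 : ∑ i, (θ' - θ) i = n * (θ' - θ) k := by
    rw [Finset.sum_congr rfl fun i _ => h5 i k]; simp [mul_sub]
  rw [h7] at h6
  have : (n : ℝ) ≠ 0 := by positivity
  have h8 := (mul_eq_zero.1 h6).resolve_left this
  simpa [sub_eq_zero] using h8

/-! ### A critical point near the linearized solution -/

/-- The weighted `ℓ¹` size of the gradient of the Green function at the vertex `i`. -/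
noncomputable def greenFlow (w z : Fin n → Fin n → ℝ) (k i : Fin n) : ℝ :=
  ∑ j, w i j * |green z k i - green z k j|

theorem greenFlow_nonneg {w : Fin n → Fin n → ℝ} (h0 : ∀ i j, 0 ≤ w i j)
    (z : Fin n → Fin n → ℝ) (k i : Fin n) : 0 ≤ greenFlow w z k i :=
  Finset.sum_nonneg fun j _ => mul_nonneg (h0 i j) (abs_nonneg _)

theorem sum_lt_abs_green_eq {w : Fin n → Fin n → ℝ} (hs : ∀ i j, w i j = w j i)
    (z : Fin n → Fin n → ℝ) (k : Fin n) :
    ∑ i, ∑ j ∈ Finset.univ.filter (fun j => j < i), w i j * |green z k i - green z k j| =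
      (∑ i, greenFlow w z k i) / 2 := by
  rw [sum_lt_eq_half]
  · rfl
  · intro i; simp
  · intro i j; rw [hs, abs_sub_comm]

theorem sum_lt_abs_green_mul_sq_le {w : Fin n → Fin n → ℝ} (hs : ∀ i j, w i j = w j i)
    (h0 : ∀ i j, 0 ≤ w i j) (z : Fin n → Fin n → ℝ) (g : Fin n → ℝ) (k : Fin n) :
    ∑ i, ∑ j ∈ Finset.univ.filter (fun j => j < i),
      w i j * |green z k i - green z k j| * (g i - g j) ^ 2 ≤
      2 * ∑ i, greenFlow w z k i * g i ^ 2 := by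
  have h1 : ∑ i, ∑ j, w i j * |green z k i - green z k j| * g j ^ 2 =
      ∑ i, greenFlow w z k i * g i ^ 2 := by
    rw [Finset.sum_comm]
    refine Finset.sum_congr rfl fun i _ => ?_
    rw [greenFlow, Finset.sum_mul]
    exact Finset.sum_congr rfl fun j _ => by rw [hs, abs_sub_comm]
  have h2 : ∑ i, ∑ j, w i j * |green z k i - green z k j| * g i ^ 2 =
      ∑ i, greenFlow w z k i * g i ^ 2 := by
    simp_rw [greenFlow, Finset.sum_mul]
  rw [sum_lt_eq_half]
  · have h3 : ∑ i, ∑ j, w i j * |green z k i - green z k j| * (g i - g j) ^ 2 ≤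
        ∑ i, ∑ j, (2 * (w i j * |green z k i - green z k j| * g i ^ 2) +
          2 * (w i j * |green z k i - green z k j| * g j ^ 2)) := by
      refine Finset.sum_le_sum fun i _ => Finset.sum_le_sum fun j _ => ?_
      have := mul_nonneg (mul_nonneg (h0 i j) (abs_nonneg (green z k i - green z k j)))
        (sq_nonneg (g i + g j))
      nlinarith
    simp_rw [Finset.sum_add_distrib, ← Finset.mul_sum] at h3
    rw [h1, h2] at h3
    linarith
  · intro i; simp
  · intro i j; rw [hs, abs_sub_comm]; ring

/-- The potential of a flow `F`: the solution of the Poisson equation for its divergence. -/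
noncomputable def potential (z F : Fin n → Fin n → ℝ) (k : Fin n) : ℝ :=
  ∑ i, ∑ j ∈ Finset.univ.filter (fun j => j < i), F i j * (green z k i - green z k j)

section

variable {z : Fin n → Fin n → ℝ} {l : ℝ}

theorem sum_potential (hn : 0 < n) (hs : ∀ i j, z i j = z j i) (hl : 0 < l) (hz : HasGap z l)
    (F : Fin n → Fin n → ℝ) : ∑ k, potential z F k = 0 := by
  simp only [potential]
  rw [Finset.sum_comm]
  refine Finset.sum_eq_zero fun i _ => ?_
  rw [Finset.sum_comm]
  refine Finset.sum_eq_zero fun j _ => ?_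
  rw [← Finset.mul_sum, Finset.sum_sub_distrib, sum_green hn hs hl hz, sum_green hn hs hl hz]
  simp

/-- The Green function inverts the Laplacian up to the mean of `v`, and the mean cancels in `v i - v
j`. -/
theorem potential_weak (hn : 0 < n) (hs : ∀ i j, z i j = z j i) (hl : 0 < l) (hz : HasGap z l)
    (F : Fin n → Fin n → ℝ) (v : Fin n → ℝ) :
    ∑ i, ∑ j ∈ Finset.univ.filter (fun j => j < i),
      z i j * (potential z F i - potential z F j) * (v i - v j) =
    ∑ i, ∑ j ∈ Finset.univ.filter (fun j => j < i), F i j * (v i - v j) := by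
  rw [← sum_mul_lap_eq_sum_lt hs]
  simp only [potential, Finset.sum_mul]
  rw [Finset.sum_comm]
  refine Finset.sum_congr rfl fun i _ => ?_
  rw [Finset.sum_comm]
  refine Finset.sum_congr rfl fun j _ => ?_
  simp_rw [mul_assoc, ← Finset.mul_sum, sub_mul, Finset.sum_sub_distrib,
    sum_green_mul_lap hn hs hl hz]
  ring

/-- Banach's fixed point theorem for the correction `h` to the linear estimate `g`. The quadratic
remainder makes `T 0` of size `Q / 2`; `S * Q ≤ 1 / 50` makes `T` a 1/2-contraction on the sup-norm
ball of radius `Q`. -/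
theorem exists_isCritical (hn : 0 < n) {w : Fin n → Fin n → ℝ} (hs : ∀ i j, w i j = w j i)
    (h0 : ∀ i j, 0 ≤ w i j) (θs : Fin n → ℝ)
    (hzw : ∀ i j, z i j = w i j * dsig (θs i - θs j)) (hl : 0 < l) (hz : HasGap z l)
    (p : Fin n → Fin n → ℝ) {g : Fin n → ℝ}
    (hg : ∀ k, g k = potential z (fun i j => w i j * (p i j - Real.sigmoid (θs i - θs j))) k)
    {S Q : ℝ} (hQ0 : 0 ≤ Q) (hS : ∀ k, ∑ i, greenFlow w z k i ≤ 2 * S)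
    (hQ : ∀ k, ∑ i, greenFlow w z k i * g i ^ 2 ≤ Q) (hSQ : S * Q ≤ 1 / 50) :
    ∃ θ : Fin n → ℝ, ∑ i, θ i = ∑ i, θs i ∧ IsCritical w p θ ∧
      ∀ k, |θ k - θs k| ≤ |g k| + Q := by
  have hzs : ∀ i j, z i j = z j i := fun i j => by
    rw [hzw, hzw, hs, ← dsig_neg, neg_sub]
  let T : (Fin n → ℝ) → Fin n → ℝ := fun h k =>
    potential z (fun i j => -(w i j * rest (θs i - θs j) ((g i + h i) - (g j + h j)))) k
  have hS0 : 0 ≤ S := by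
    have := (Finset.sum_nonneg fun i _ => greenFlow_nonneg h0 z ⟨0, hn⟩ i).trans (hS ⟨0, hn⟩)
    linarith
  have hA : ∀ k, ∑ i, ∑ j ∈ Finset.univ.filter (fun j => j < i),
      w i j * |green z k i - green z k j| ≤ S := fun k => by
    rw [sum_lt_abs_green_eq hs]; linarith [hS k]
  have hB2 : ∀ k, ∑ i, ∑ j ∈ Finset.univ.filter (fun j => j < i),
      w i j * |green z k i - green z k j| * (g i - g j) ^ 2 ≤ 2 * Q := fun k =>
    (sum_lt_abs_green_mul_sq_le hs h0 z g k).trans (by linarith [hQ k])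
  -- Cauchy–Schwarz between `hA` and `hB2`: the square is at most S * 2Q ≤ 1/25.
  have hB : ∀ k, ∑ i, ∑ j ∈ Finset.univ.filter (fun j => j < i),
      w i j * |green z k i - green z k j| * |g i - g j| ≤ 1 / 5 := by
    intro k
    refine le_of_abs_le (abs_le_of_sq_le_sq ?_ (by norm_num))
    have hcs : (∑ i, ∑ j ∈ Finset.univ.filter (fun j => j < i),
        w i j * |green z k i - green z k j| * |g i - g j|) ^ 2 ≤
        (∑ i, ∑ j ∈ Finset.univ.filter (fun j => j < i), w i j * |green z k i - green z k j|) *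
        ∑ i, ∑ j ∈ Finset.univ.filter (fun j => j < i),
          w i j * |green z k i - green z k j| * (g i - g j) ^ 2 := by
      simp only [Finset.sum_sigma']
      have hpos : ∀ q : (_ : Fin n) × Fin n, 0 ≤ w q.1 q.2 * |green z k q.1 - green z k q.2| :=
        fun q => mul_nonneg (h0 _ _) (abs_nonneg _)
      refine Finset.sum_sq_le_sum_mul_sum_of_sq_le_mul _ (fun q _ => hpos q)
        (fun q _ => mul_nonneg (hpos q) (sq_nonneg _)) (fun q _ => le_of_eq ?_)
      rw [mul_pow _ (|g q.1 - g q.2|), sq_abs]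
      ring
    refine hcs.trans ((mul_le_mul (hA k) (hB2 k) ?_ hS0).trans (by linarith))
    exact Finset.sum_nonneg fun i _ => Finset.sum_nonneg fun j _ =>
      mul_nonneg (mul_nonneg (h0 _ _) (abs_nonneg _)) (sq_nonneg _)
  have hT0 : ‖T 0‖ ≤ Q / 2 := by
    rw [pi_norm_le_iff_of_nonneg (by linarith)]
    intro k
    simp only [T, potential, Pi.zero_apply, add_zero, Real.norm_eq_abs]
    have : ∑ i, ∑ j ∈ Finset.univ.filter (fun j => j < i),
        |-(w i j * rest (θs i - θs j) (g i - g j)) * (green z k i - green z k j)| ≤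
        ∑ i, ∑ j ∈ Finset.univ.filter (fun j => j < i),
          1 / 4 * (w i j * |green z k i - green z k j| * (g i - g j) ^ 2) := by
      refine Finset.sum_le_sum fun i _ => Finset.sum_le_sum fun j _ => ?_
      rw [abs_mul, abs_neg, abs_mul, abs_of_nonneg (h0 i j)]
      have := mul_le_mul_of_nonneg_left (abs_rest_le (θs i - θs j) (g i - g j))
        (mul_nonneg (h0 i j) (abs_nonneg (green z k i - green z k j)))
      linarith
    simp_rw [← Finset.mul_sum] at this
    refine (Finset.abs_sum_le_sum_abs _ _).trans
      ((Finset.sum_le_sum fun i _ => Finset.abs_sum_le_sum_abs _ _).trans (this.trans ?_))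
    linarith [hB2 k]
  have hT : ∀ h h' : Fin n → ℝ, ‖h‖ ≤ Q → ‖h'‖ ≤ Q → ‖T h - T h'‖ ≤ 1 / 2 * ‖h - h'‖ := by
    intro h h' hh hh'
    rw [pi_norm_le_iff_of_nonneg (by positivity)]
    intro k
    simp only [T, potential, Pi.sub_apply, Real.norm_eq_abs]
    simp_rw [← Finset.sum_sub_distrib]
    have hterm : ∑ i, ∑ j ∈ Finset.univ.filter (fun j => j < i),
        |(-(w i j * rest (θs i - θs j) ((g i + h i) - (g j + h j))) *
            (green z k i - green z k j) -
          -(w i j * rest (θs i - θs j) ((g i + h' i) - (g j + h' j))) *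
            (green z k i - green z k j))| ≤
        ∑ i, ∑ j ∈ Finset.univ.filter (fun j => j < i),
          (‖h - h'‖ * (w i j * |green z k i - green z k j| * |g i - g j|) +
            2 * Q * ‖h - h'‖ * (w i j * |green z k i - green z k j|)) := by
      refine Finset.sum_le_sum fun i _ => Finset.sum_le_sum fun j _ => ?_
      have e1 : ∀ a b c d : ℝ, -(a * b) * d - -(a * c) * d = a * d * (c - b) := by
        intros; ring
      rw [e1, abs_mul, abs_mul, abs_of_nonneg (h0 i j)]
      have c1 : ∀ i, |h i| ≤ Q := fun i => (norm_le_pi_norm h i).trans hh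
      have c2 : ∀ i, |h' i| ≤ Q := fun i => (norm_le_pi_norm h' i).trans hh'
      have c3 : ∀ i, |h i - h' i| ≤ ‖h - h'‖ := fun i => norm_le_pi_norm (h - h') i
      have e2 := abs_rest_sub_le (θs i - θs j) ((g i + h' i) - (g j + h' j))
        ((g i + h i) - (g j + h j))
      have e3 : |(g i + h' i) - (g j + h' j)| ≤ |g i - g j| + 2 * Q := by
        have : (g i + h' i) - (g j + h' j) = (g i - g j) + (h' i - h' j) := by ring
        rw [this]
        refine (abs_add_le _ _).trans ?_
        have := abs_sub (h' i) (h' j)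
        linarith [c2 i, c2 j]
      have e4 : |(g i + h i) - (g j + h j)| ≤ |g i - g j| + 2 * Q := by
        have : (g i + h i) - (g j + h j) = (g i - g j) + (h i - h j) := by ring
        rw [this]
        refine (abs_add_le _ _).trans ?_
        have := abs_sub (h i) (h j)
        linarith [c1 i, c1 j]
      have e5 : |(g i + h' i) - (g j + h' j) - ((g i + h i) - (g j + h j))| ≤ 2 * ‖h - h'‖ := by
        have : (g i + h' i) - (g j + h' j) - ((g i + h i) - (g j + h j)) =
          (h j - h' j) - (h i - h' i) := by ring
        rw [this]
        have := abs_sub (h j - h' j) (h i - h' i)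
        linarith [c3 i, c3 j]
      have e6 : |rest (θs i - θs j) ((g i + h' i) - (g j + h' j)) -
          rest (θs i - θs j) ((g i + h i) - (g j + h j))| ≤
          ‖h - h'‖ * (|g i - g j| + 2 * Q) := by
        refine e2.trans ?_
        calc _ ≤ 1 / 4 * ((|g i - g j| + 2 * Q) + (|g i - g j| + 2 * Q)) * (2 * ‖h - h'‖) := by
              gcongr
          _ = _ := by ring
      have := mul_le_mul_of_nonneg_left e6
        (mul_nonneg (h0 i j) (abs_nonneg (green z k i - green z k j)))
      linarith
    simp_rw [Finset.sum_add_distrib, ← Finset.mul_sum] at hterm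
    refine (Finset.abs_sum_le_sum_abs _ _).trans
      -- The Lipschitz constant obtained is 1/5 + 2 * Q * S, below 1/2.
      ((Finset.sum_le_sum fun i _ => Finset.abs_sum_le_sum_abs _ _).trans (hterm.trans ?_))
    have h1 := mul_le_mul_of_nonneg_left (hB k) (norm_nonneg (h - h'))
    have h2 := mul_le_mul_of_nonneg_left (hA k)
      (mul_nonneg (mul_nonneg two_pos.le hQ0) (norm_nonneg (h - h')))
    have h3 := mul_le_mul_of_nonneg_right hSQ (norm_nonneg (h - h'))
    have h4 := norm_nonneg (h - h')
    linarith
  have hmaps : Set.MapsTo T (Metric.closedBall 0 Q) (Metric.closedBall 0 Q) := by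
    intro h hh
    rw [mem_closedBall_zero_iff] at hh ⊢
    have h1 := hT h 0 hh (by simpa using hQ0)
    have h2 : ‖T h‖ ≤ ‖T h - T 0‖ + ‖T 0‖ := by
      simpa using norm_add_le (T h - T 0) (T 0)
    rw [sub_zero] at h1
    linarith
  have hcontr : ContractingWith (1 / 2) (hmaps.restrict T _ _) := by
    refine ⟨by norm_num, LipschitzWith.of_dist_le_mul fun a b => ?_⟩
    have := hT a b (mem_closedBall_zero_iff.1 a.2) (mem_closedBall_zero_iff.1 b.2)
    rw [Subtype.dist_eq, Subtype.dist_eq, dist_eq_norm, dist_eq_norm]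
    simpa using this
  obtain ⟨h, hhQ, hfix, -⟩ := hcontr.exists_fixedPoint' Metric.isClosed_closedBall.isComplete
    hmaps (x := 0) (by simpa using hQ0) (edist_ne_top _ _)
  rw [mem_closedBall_zero_iff] at hhQ
  have hfix' : ∀ k, h k = T h k := fun k => (congrFun hfix k).symm
  have hsumg : ∑ k, g k = 0 := by simp_rw [hg]; exact sum_potential hn hzs hl hz _
  have hsumh : ∑ k, h k = 0 := by simp_rw [hfix', T]; exact sum_potential hn hzs hl hz _
  refine ⟨fun k => θs k + (g k + h k), ?_, fun v => ?_, fun k => ?_⟩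
  · simp [Finset.sum_add_distrib, hsumg, hsumh]
  · have w1 := potential_weak hn hzs hl hz
      (fun i j => w i j * (p i j - Real.sigmoid (θs i - θs j))) v
    have w2 := potential_weak hn hzs hl hz
      (fun i j => -(w i j * rest (θs i - θs j) ((g i + h i) - (g j + h j)))) v
    simp_rw [← hg] at w1
    change ∑ i, ∑ j ∈ Finset.univ.filter (fun j => j < i), z i j * (T h i - T h j) * (v i - v j) = _
      at w2
    simp_rw [← hfix'] at w2
    -- Adding the weak equations of `g` and `h` reassembles the Taylor expansion of the logistic
    -- function, which is the critical equation.
    rw [← sub_eq_zero, ← Finset.sum_sub_distrib] at w1 w2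
    have w3 := congrArg₂ (· + ·) w1 w2
    simp only [← Finset.sum_sub_distrib, ← Finset.sum_add_distrib, add_zero] at w3
    rw [← w3]
    refine Finset.sum_congr rfl fun i _ => Finset.sum_congr rfl fun j _ => ?_
    have e : θs i + (g i + h i) - (θs j + (g j + h j)) =
      (θs i - θs j) + ((g i + h i) - (g j + h j)) := by ring
    rw [e, hzw, rest]
    ring
  · rw [add_sub_cancel_left]
    exact (abs_add_le _ _).trans (add_le_add le_rfl ((norm_le_pi_norm h k).trans hhQ))

end

end BTL

/-! ### The spectral gap of the weighted Laplacian -/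

namespace BTL

variable {n : ℕ}

open scoped Matrix

theorem dotProduct_wLaplacian_mulVec (w : Fin n → Fin n → ℝ) (u v : Fin n → ℝ) :
    u ⬝ᵥ (wLaplacian w *ᵥ v) = ∑ i, ∑ j ∈ Finset.univ.filter (fun j => j < i),
      w i j * (u i - u j) * (v i - v j) := by
  have hd : ∀ (i j : Fin n) (x : Fin n → ℝ), edgeVec i j ⬝ᵥ x = x i - x j := fun i j x => by
    simp [edgeVec, sub_dotProduct]
  rw [wLaplacian, Matrix.sum_mulVec, dotProduct_sum]
  refine Finset.sum_congr rfl fun i _ => ?_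
  rw [Matrix.sum_mulVec, dotProduct_sum]
  refine Finset.sum_congr rfl fun j _ => ?_
  rw [Matrix.smul_mulVec, dotProduct_smul, Matrix.vecMulVec_mulVec, hd, dotProduct_smul,
    dotProduct_comm, hd]
  simp
  ring

theorem dotProduct_wLaplacian_self {w : Fin n → Fin n → ℝ} (hs : ∀ i j, w i j = w j i)
    (v : Fin n → ℝ) : v ⬝ᵥ (wLaplacian w *ᵥ v) = energy w v := by
  rw [dotProduct_wLaplacian_mulVec, energy_eq_sum_lt hs]
  exact Finset.sum_congr rfl fun i _ => Finset.sum_congr rfl fun j _ => by ring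

/-- An orthonormal eigenbasis of the weighted Laplacian in which `last` is the index of the smallest
and `a` the index of the second smallest eigenvalue. -/
theorem exists_eigenbasis (hn : 2 ≤ n) (w : Fin n → Fin n → ℝ) :
    ∃ (β : Fin n → Fin n → ℝ) (μ : Fin n → ℝ) (a last : Fin n), a ≠ last ∧
      μ a = spectralGap hn w ∧ μ last ≤ spectralGap hn w ∧
      (∀ i, i ≠ last → spectralGap hn w ≤ μ i) ∧
      (∀ i, wLaplacian w *ᵥ β i = μ i • β i) ∧
      (∀ i j, β i ⬝ᵥ β j = if i = j then 1 else 0) ∧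
      ∀ v : Fin n → ℝ, v = ∑ i, (β i ⬝ᵥ v) • β i := by
  let hA := wLaplacian_isHermitian w
  let e : Fin (Fintype.card (Fin n)) ≃ Fin n := Fintype.equivOfCardEq (Fintype.card_fin _)
  have hcard : Fintype.card (Fin n) = n := Fintype.card_fin n
  let ia : Fin (Fintype.card (Fin n)) := ⟨n - 2, by rw [hcard]; omega⟩
  let il : Fin (Fintype.card (Fin n)) := ⟨n - 1, by rw [hcard]; omega⟩
  have hinner : ∀ x y : EuclideanSpace ℝ (Fin n), inner ℝ x y = x.ofLp ⬝ᵥ y.ofLp := by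
    intro x y
    rw [EuclideanSpace.inner_eq_star_dotProduct, dotProduct_comm]
    simp
  refine ⟨fun i => (hA.eigenvectorBasis i).ofLp, hA.eigenvalues, e ia, e il, ?_, ?_, ?_, ?_, ?_,
    ?_, ?_⟩
  · rw [Ne, e.injective.eq_iff]
    simp only [ia, il, Fin.mk.injEq]
    omega
  · change hA.eigenvalues₀ (e.symm (e ia)) = _
    rw [e.symm_apply_apply]
    rfl
  · change hA.eigenvalues₀ (e.symm (e il)) ≤ _
    rw [e.symm_apply_apply]
    refine hA.eigenvalues₀_antitone ?_
    simp only [il, Fin.mk_le_mk]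
    omega
  · intro i hi
    change _ ≤ hA.eigenvalues₀ (e.symm i)
    refine hA.eigenvalues₀_antitone ?_
    have h1 : e.symm i ≠ il := fun h => hi (by rw [← h, e.apply_symm_apply])
    have h2 := (e.symm i).2
    have h3 : ((e.symm i : Fin _) : ℕ) ≠ n - 1 := fun h => h1 (Fin.ext h)
    rw [Fin.le_def]
    change ((e.symm i : Fin _) : ℕ) ≤ n - 2
    omega
  · exact fun i => hA.mulVec_eigenvectorBasis i
  · intro i j
    rw [← hinner]
    exact orthonormal_iff_ite.1 hA.eigenvectorBasis.orthonormal i j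
  · intro v
    have := hA.eigenvectorBasis.sum_repr' (WithLp.toLp 2 v)
    simp_rw [hinner] at this
    have h2 := congrArg WithLp.ofLp this
    simpa using h2.symm

theorem dotProduct_self_eq_sum {β : Fin n → Fin n → ℝ}
    (hβ : ∀ v : Fin n → ℝ, v = ∑ i, (β i ⬝ᵥ v) • β i) (v : Fin n → ℝ) :
    ∑ i, v i ^ 2 = ∑ i, (β i ⬝ᵥ v) ^ 2 := by
  have h1 : v ⬝ᵥ v = ∑ i, (β i ⬝ᵥ v) ^ 2 := by
    nth_rewrite 2 [hβ v]
    rw [dotProduct_sum]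
    refine Finset.sum_congr rfl fun i _ => ?_
    rw [dotProduct_smul, dotProduct_comm, smul_eq_mul, pow_two]
  rw [← h1]
  exact Finset.sum_congr rfl fun i _ => pow_two _

theorem dotProduct_mulVec_eq_sum {A : Matrix (Fin n) (Fin n) ℝ} {β : Fin n → Fin n → ℝ}
    {μ : Fin n → ℝ} (hA : ∀ i, A *ᵥ β i = μ i • β i)
    (hβ : ∀ v : Fin n → ℝ, v = ∑ i, (β i ⬝ᵥ v) • β i) (v : Fin n → ℝ) :
    v ⬝ᵥ (A *ᵥ v) = ∑ i, μ i * (β i ⬝ᵥ v) ^ 2 := by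
  nth_rewrite 2 [hβ v]
  rw [Matrix.mulVec_sum, dotProduct_sum]
  refine Finset.sum_congr rfl fun i _ => ?_
  rw [Matrix.mulVec_smul, hA, dotProduct_smul, dotProduct_smul, dotProduct_comm, smul_eq_mul,
    smul_eq_mul]
  ring

/-- If the second eigenvalue is positive, all eigenvectors but the last are orthogonal to the
constants, which lie in the kernel. So the last one spans the constants, and a zero-sum vector has
no component along it. -/
theorem hasGap_spectralGap (hn : 2 ≤ n) {w : Fin n → Fin n → ℝ} (hs : ∀ i j, w i j = w j i)
    (h0 : ∀ i j, 0 ≤ w i j) : HasGap w (spectralGap hn w) := by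
  intro v hv
  rcases le_or_gt (spectralGap hn w) 0 with hg | hg
  · exact (mul_nonpos_of_nonpos_of_nonneg hg (Finset.sum_nonneg fun i _ => sq_nonneg _)).trans
      (energy_nonneg h0 v)
  obtain ⟨β, μ, a, last, -, -, -, hμ, hA, -, hβ⟩ := exists_eigenbasis hn w
  let one : Fin n → ℝ := fun _ => 1
  have h1 : ∀ i, i ≠ last → β i ⬝ᵥ one = 0 := by
    intro i hi
    have h2 : one ⬝ᵥ (wLaplacian w *ᵥ β i) = 0 := by
      rw [dotProduct_wLaplacian_mulVec]; simp [one]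
    rw [hA, dotProduct_smul, smul_eq_mul] at h2
    rw [dotProduct_comm]
    exact (mul_eq_zero.1 h2).resolve_left (by linarith [hμ i hi])
  have h3 : one = (β last ⬝ᵥ one) • β last := by
    nth_rewrite 1 [hβ one]
    refine Finset.sum_eq_single last (fun i _ hi => ?_) (fun h => absurd (Finset.mem_univ _) h)
    rw [h1 i hi, zero_smul]
  have h4 : β last ⬝ᵥ v = 0 := by
    have h5 : one ⬝ᵥ v = 0 := by simpa [one, dotProduct] using hv
    rw [h3, smul_dotProduct, smul_eq_mul] at h5
    refine (mul_eq_zero.1 h5).resolve_left fun hc => ?_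
    have := congrFun h3 last
    rw [hc] at this
    simp [one] at this
  rw [dotProduct_self_eq_sum hβ, ← dotProduct_wLaplacian_self hs, dotProduct_mulVec_eq_sum hA hβ,
    Finset.mul_sum]
  refine Finset.sum_le_sum fun i _ => ?_
  by_cases hi : i = last
  · rw [hi, h4]; simp
  · exact mul_le_mul_of_nonneg_right (hμ i hi) (sq_nonneg _)

/-- The plane spanned by the two lowest eigenvectors meets the zero-sum hyperplane in a nonzero
vector. -/
theorem exists_energy_le_spectralGap (hn : 2 ≤ n) {w : Fin n → Fin n → ℝ}
    (hs : ∀ i j, w i j = w j i) :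
    ∃ v : Fin n → ℝ, ∑ i, v i = 0 ∧ 0 < ∑ i, v i ^ 2 ∧
      energy w v ≤ spectralGap hn w * ∑ i, v i ^ 2 := by
  obtain ⟨β, μ, a, last, hal, hμa, hμl, -, hA, ho, hβ⟩ := exists_eigenbasis hn w
  let one : Fin n → ℝ := fun _ => 1
  obtain ⟨x, y, hxy, hpos⟩ : ∃ x y : ℝ, x * (β a ⬝ᵥ one) + y * (β last ⬝ᵥ one) = 0 ∧
      0 < x ^ 2 + y ^ 2 := by
    by_cases h : β a ⬝ᵥ one = 0
    · exact ⟨1, 0, by rw [h]; ring, by norm_num⟩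
    · exact ⟨β last ⬝ᵥ one, -(β a ⬝ᵥ one), by ring, by
        rw [neg_sq]; exact add_pos_of_nonneg_of_pos (sq_nonneg _) (sq_pos_of_ne_zero h)⟩
  have hv : ∀ i, β i ⬝ᵥ (x • β a + y • β last) =
      (if i = a then x else 0) + (if i = last then y else 0) := by
    intro i
    rw [dotProduct_add, dotProduct_smul, dotProduct_smul, ho, ho]
    simp
  have hsq : ∀ i, (β i ⬝ᵥ (x • β a + y • β last)) ^ 2 =
      (if i = a then x ^ 2 else 0) + (if i = last then y ^ 2 else 0) := by
    intro i
    rw [hv]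
    by_cases h1 : i = a
    · have : i ≠ last := fun h => hal (h1.symm.trans h)
      simp [h1, hal]
    · by_cases h2 : i = last <;> simp [h1, h2, hal.symm]
  have hnorm : ∑ i, (x • β a + y • β last) i ^ 2 = x ^ 2 + y ^ 2 := by
    rw [dotProduct_self_eq_sum hβ]
    simp_rw [hsq, Finset.sum_add_distrib]
    simp
  refine ⟨x • β a + y • β last, ?_, by rwa [hnorm], ?_⟩
  · have : ∑ i, (x • β a + y • β last) i = x * (β a ⬝ᵥ one) + y * (β last ⬝ᵥ one) := by
      simp [one, dotProduct, Finset.sum_add_distrib, Finset.mul_sum]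
    rw [this, hxy]
  · rw [hnorm, ← dotProduct_wLaplacian_self hs, dotProduct_mulVec_eq_sum hA hβ]
    simp_rw [hsq, mul_add, Finset.sum_add_distrib]
    simp only [mul_ite, mul_zero, Finset.sum_ite_eq', Finset.mem_univ, if_true, hμa]
    gcongr

theorem spectralGap_pos (hn : 2 ≤ n) {w : Fin n → Fin n → ℝ} (hs : ∀ i j, w i j = w j i)
    (h0 : ∀ i j, 0 ≤ w i j) (hc : (supportGraph w).Connected) : 0 < spectralGap hn w := by
  obtain ⟨v, hv, hpos, hle⟩ := exists_energy_le_spectralGap hn hs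
  by_contra hg
  have h1 : energy w v = 0 := le_antisymm
    (hle.trans (mul_nonpos_of_nonpos_of_nonneg (not_lt.1 hg) hpos.le)) (energy_nonneg h0 v)
  have hp : ∀ i j, 0 ≤ w i j * (v i - v j) ^ 2 := fun i j => mul_nonneg (h0 i j) (sq_nonneg _)
  have h2 : ∀ i j, w i j ≠ 0 → v i = v j := by
    intro i j hw
    rw [energy, div_eq_zero_iff] at h1
    have h3 := h1.resolve_right two_ne_zero
    rw [Finset.sum_eq_zero_iff_of_nonneg fun i _ => Finset.sum_nonneg fun j _ => hp i j] at h3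
    have h4 := h3 i (Finset.mem_univ i)
    rw [Finset.sum_eq_zero_iff_of_nonneg fun j _ => hp i j] at h4
    have h5 := (mul_eq_zero.1 (h4 j (Finset.mem_univ j))).resolve_left hw
    exact sub_eq_zero.1 (pow_eq_zero_iff two_ne_zero |>.1 h5)
  have h3 := eq_of_supportGraph_connected hc h2
  have h4 : ∀ k, v k = 0 := by
    intro k
    rw [Finset.sum_congr rfl fun i _ => h3 i k] at hv
    have hn' : (n : ℝ) ≠ 0 := by positivity
    simpa [hn'] using hv
  simp [h4] at hpos

/-- The spectral gap of nonnegative symmetric weights, and zero for other weights. -/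
noncomputable def symmGap (hn : 2 ≤ n) (w : Fin n → Fin n → ℝ) : ℝ :=
  open scoped Classical in
  if (∀ i j, w i j = w j i) ∧ ∀ i j, 0 ≤ w i j then spectralGap hn w else 0

theorem le_spectralGap_iff (hn : 2 ≤ n) {w : Fin n → Fin n → ℝ} (hs : ∀ i j, w i j = w j i)
    (h0 : ∀ i j, 0 ≤ w i j) (x : ℝ) : x ≤ spectralGap hn w ↔ HasGap w x := by
  constructor
  · intro hx v hv
    exact (mul_le_mul_of_nonneg_right hx (Finset.sum_nonneg fun i _ => sq_nonneg _)).trans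
      (hasGap_spectralGap hn hs h0 v hv)
  · intro hx
    obtain ⟨v, hv, hpos, hle⟩ := exists_energy_le_spectralGap hn hs
    exact le_of_mul_le_mul_right ((hx v hv).trans hle) hpos

/-- On symmetric nonnegative weights, `le_spectralGap_iff` turns each superlevel set into the closed
condition `HasGap`. Off this closed set of weights the function is zero. -/
theorem measurable_symmGap (hn : 2 ≤ n) : Measurable (symmGap (n := n) hn) := by
  classical
  have hsym : IsClosed {w : Fin n → Fin n → ℝ | (∀ i j, w i j = w j i) ∧ ∀ i j, 0 ≤ w i j} := by
    simp only [Set.ofPred_and, Set.ofPred_forall]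
    refine IsClosed.inter ?_ ?_
    · exact isClosed_iInter fun i => isClosed_iInter fun j =>
        isClosed_eq (by fun_prop) (by fun_prop)
    · exact isClosed_iInter fun i => isClosed_iInter fun j =>
        isClosed_le (by fun_prop) (by fun_prop)
  have hgap : ∀ x, IsClosed {w : Fin n → Fin n → ℝ | HasGap w x} := by
    intro x
    simp only [HasGap, Set.ofPred_forall]
    refine isClosed_iInter fun v => isClosed_iInter fun _ => isClosed_le continuous_const ?_
    unfold energy
    fun_prop
  refine measurable_of_Ici fun x => ?_
  have : symmGap hn ⁻¹' Set.Ici x =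
      ({w : Fin n → Fin n → ℝ | (∀ i j, w i j = w j i) ∧ ∀ i j, 0 ≤ w i j} ∩ {w | HasGap w x}) ∪
      ({w : Fin n → Fin n → ℝ | (∀ i j, w i j = w j i) ∧ ∀ i j, 0 ≤ w i j}ᶜ ∩ {_w | x ≤ 0}) := by
    ext w
    simp only [Set.mem_preimage, Set.mem_Ici, symmGap, Set.mem_union, Set.mem_inter_iff,
      Set.mem_ofPred_eq, Set.mem_compl_iff]
    split_ifs with h
    · rw [le_spectralGap_iff hn h.1 h.2]; tauto
    · tauto
  rw [this]
  refine (hsym.measurableSet.inter (hgap x).measurableSet).union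
    (hsym.measurableSet.compl.inter (MeasurableSet.const _))

end BTL

/-! ### The noise of the comparisons -/

namespace BTL

variable {n L : ℕ}

theorem sum_comparisonIdx (G : SimpleGraph (Fin n)) [DecidableRel G.Adj]
    (f : Fin n → Fin n → Fin L → ℝ) (hf : ∀ i j l, ¬ G.Adj i j → f i j l = 0) :
    ∑ q : ComparisonIdx G L, f q.1.1.1 q.1.1.2 q.2 =
      ∑ i, ∑ j ∈ Finset.univ.filter (fun j => j < i), ∑ l, f i j l := by
  rw [Fintype.sum_prod_type]
  rw [← Finset.sum_subtype (Finset.univ.filter fun p : Fin n × Fin n => p.2 < p.1 ∧ G.Adj p.1 p.2)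
    (fun x => by simp) (fun p => ∑ l, f p.1 p.2 l), Finset.sum_filter, Fintype.sum_prod_type]
  refine Finset.sum_congr rfl fun i _ => ?_
  rw [Finset.sum_filter]
  refine Finset.sum_congr rfl fun j _ => ?_
  by_cases h1 : j < i
  · by_cases h2 : G.Adj i j
    · simp [h1, h2]
    · simp [h1, h2, hf i j _ h2]
  · simp [h1]

/-- The centered linear statistic of the comparisons attached to the potential `u`. -/
noncomputable def noiseSum (G : SimpleGraph (Fin n)) [DecidableRel G.Adj] (θ : Fin n → ℝ)
    (w : Fin n → Fin n → ℝ) (o : ComparisonIdx G L → Bool) (u : Fin n → ℝ) : ℝ :=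
  ∑ q : ComparisonIdx G L, w q.1.1.1 q.1.1.2 / L * (u q.1.1.1 - u q.1.1.2) *
    (winRev (o q) - Real.sigmoid (θ q.1.1.1 - θ q.1.1.2))

theorem noiseSum_observed {Ω : Type*} (G : SimpleGraph (Fin n)) [DecidableRel G.Adj] (hL : 0 < L)
    (θ : Fin n → ℝ) {w : Fin n → Fin n → ℝ} (hw : ∀ i j, ¬ G.Adj i j → w i j = 0)
    (y : Fin n → Fin n → Fin L → Ω → Bool) (ω : Ω) (z : Fin n → Fin n → ℝ) (k : Fin n) :
    noiseSum G θ w (observed G y ω) (green z k) = potential z (fun i j => w i j *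
      (winFreq (fun i j l => y i j l ω) i j - Real.sigmoid (θ i - θ j))) k := by
  have hL' : (L : ℝ) ≠ 0 := by positivity
  have := sum_comparisonIdx G (fun i j (l : Fin L) => w i j / L * (green z k i - green z k j) *
    (winRev (y i j l ω) - Real.sigmoid (θ i - θ j)))
    (fun i j l h => by rw [hw i j h]; simp)
  rw [noiseSum]
  refine this.trans ?_
  rw [potential]
  refine Finset.sum_congr rfl fun i _ => Finset.sum_congr rfl fun j _ => ?_
  rw [← Finset.mul_sum, Finset.sum_sub_distrib, winFreq]
  simp
  field_simp

theorem measurable_winRev : Measurable winRev := measurable_of_finite _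

section Moments

variable {Ω : Type*} [MeasurableSpace Ω] {μ : Measure Ω}
  {G : SimpleGraph (Fin n)} {θ : Fin n → ℝ} {y : Fin n → Fin n → Fin L → Ω → Bool}

theorem measurable_observed (hy : IsBTLSample μ G θ y) : Measurable (observed G y) :=
  measurable_pi_lambda _ fun q => hy.measurable _ _ _ q.1.2.1 q.1.2.2

theorem integral_winRev_observed [IsProbabilityMeasure μ] (hy : IsBTLSample μ G θ y)
    (q : ComparisonIdx G L) :
    ∫ ω, winRev (observed G y ω q) ∂μ = Real.sigmoid (θ q.1.1.1 - θ q.1.1.2) := by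
  have hm : MeasurableSet {ω | y q.1.1.1 q.1.1.2 q.2 ω = true} :=
    hy.measurable _ _ _ q.1.2.1 q.1.2.2 (measurableSet_singleton true)
  have h1 : (fun ω => winRev (observed G y ω q)) =
      fun ω => 1 - Set.indicator {ω | y q.1.1.1 q.1.1.2 q.2 ω = true} (fun _ => (1 : ℝ)) ω := by
    funext ω
    by_cases h : y q.1.1.1 q.1.1.2 q.2 ω = true <;> simp [winRev, observed, h]
  rw [h1, integral_sub (integrable_const _) ((integrable_const _).indicator hm),
    integral_indicator_const _ hm, hy.prob _ _ _ q.1.2.1 q.1.2.2, Real.sigmoid_def, neg_sub,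
    Real.exp_sub]
  have h2 := Real.exp_pos (θ q.1.1.1)
  have h3 := Real.exp_pos (θ q.1.1.2)
  simp
  field_simp
  ring

/-- Hoeffding's lemma gives each comparison the proxy (coefficient)²/4. Summing the `L` repetitions
and bounding one of the two factors `w i j` by `W` leaves the energy. -/
theorem lintegral_exp_noiseSum_le [IsProbabilityMeasure μ] [DecidableRel G.Adj]
    (hy : IsBTLSample μ G θ y) (hL : 0 < L)
    {w : Fin n → Fin n → ℝ} (hs : ∀ i j, w i j = w j i)
    (h0 : ∀ i j, 0 ≤ w i j) (hw : ∀ i j, ¬ G.Adj i j → w i j = 0) {W : ℝ}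
    (hW : ∀ i j, w i j ≤ W) (u : Fin n → ℝ) :
    ∫⁻ ω, ENNReal.ofReal (Real.exp (noiseSum G θ w (observed G y ω) u)) ∂μ ≤
      ENNReal.ofReal (Real.exp (W * energy w u / (4 * L) / 2)) := by
  have hL' : (L : ℝ) ≠ 0 := by positivity
  let a : ComparisonIdx G L → ℝ := fun q => w q.1.1.1 q.1.1.2 / L * (u q.1.1.1 - u q.1.1.2)
  have h1 : ∀ q : ComparisonIdx G L, HasSubgaussianMGF
      (fun ω => a q * (winRev (observed G y ω q) - Real.sigmoid (θ q.1.1.1 - θ q.1.1.2)))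
      (a q ^ 2 / 4).toNNReal μ := by
    intro q
    have h2 := hasSubgaussianMGF_of_mem_Icc (μ := μ) (a := 0) (b := 1)
      (X := fun ω => winRev (observed G y ω q))
      (measurable_winRev.comp ((measurable_pi_apply q).comp (measurable_observed hy))).aemeasurable
      (Filter.Eventually.of_forall fun ω => by
        rw [winRev]; split_ifs <;> simp)
    rw [integral_winRev_observed hy] at h2
    have h3 : (a q ^ 2 / 4).toNNReal =
        ⟨a q ^ 2, sq_nonneg _⟩ * ((‖(1 : ℝ) - 0‖₊ / 2) ^ 2) := by
      apply NNReal.eq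
      rw [Real.coe_toNNReal _ (by positivity)]
      change _ = a q ^ 2 * (((‖(1 : ℝ) - 0‖₊ / 2) ^ 2 : NNReal) : ℝ)
      simp
      ring
    rw [h3]
    exact h2.const_mul (a q)
  have hind : iIndepFun (fun (q : ComparisonIdx G L) ω =>
      a q * (winRev (observed G y ω q) - Real.sigmoid (θ q.1.1.1 - θ q.1.1.2))) μ :=
    hy.indep.comp (fun q b => a q * (winRev b - Real.sigmoid (θ q.1.1.1 - θ q.1.1.2)))
      (fun q => measurable_of_finite _)
  have h3 := HasSubgaussianMGF.sum_of_iIndepFun hind (s := Finset.univ) (fun q _ => h1 q)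
  have h4 := h3.mgf_le 1
  have h5 := h3.integrable_exp_mul 1
  simp only [mgf, one_mul] at h4 h5
  change Integrable (fun ω => Real.exp (noiseSum G θ w (observed G y ω) u)) μ at h5
  rw [← ofReal_integral_eq_lintegral_ofReal h5
    (Filter.Eventually.of_forall fun ω => (Real.exp_pos _).le)]
  refine ENNReal.ofReal_le_ofReal (h4.trans (Real.exp_le_exp.2 ?_))
  rw [one_pow, mul_one]
  refine div_le_div_of_nonneg_right ?_ two_pos.le
  rw [NNReal.coe_sum]
  have h6 : ∀ q : ComparisonIdx G L, ((a q ^ 2 / 4).toNNReal : ℝ) = a q ^ 2 / 4 := fun q =>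
    Real.coe_toNNReal _ (by positivity)
  have h7 : ∑ q : ComparisonIdx G L, a q ^ 2 / 4 ≤ W * energy w u / (4 * L) := by
    have h8 := sum_comparisonIdx G
      (fun i j (_ : Fin L) => (w i j / L * (u i - u j)) ^ 2 / 4)
      (fun i j l h => by rw [hw i j h]; simp)
    refine (le_of_eq h8).trans ?_
    rw [energy_eq_sum_lt hs, Finset.mul_sum, Finset.sum_div]
    refine Finset.sum_le_sum fun i _ => ?_
    rw [Finset.mul_sum, Finset.sum_div]
    refine Finset.sum_le_sum fun j _ => ?_
    rw [Finset.sum_const, Finset.card_univ, Fintype.card_fin, nsmul_eq_mul]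
    have h9 : (L : ℝ) * ((w i j / L * (u i - u j)) ^ 2 / 4) =
        w i j * (w i j * (u i - u j) ^ 2) / (4 * L) := by
      field_simp
    rw [h9]
    refine div_le_div_of_nonneg_right ?_ (by positivity)
    exact mul_le_mul_of_nonneg_right (hW i j) (mul_nonneg (h0 i j) (sq_nonneg _))
  exact (le_of_eq (Finset.sum_congr rfl fun q _ => h6 q)).trans h7

/-- A tail bound for diagonal quadratic forms of sub-Gaussian vectors. -/
theorem measure_sum_mul_sq_gt_le [IsProbabilityMeasure μ] (hn : 2 ≤ n) (g : Ω → Fin n → ℝ)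
    (hg : Measurable g) {s : ℝ}
    (hs : 0 < s)
    (hsub : ∀ t : Fin n → ℝ, ∫⁻ ω, ENNReal.ofReal (Real.exp (∑ i, t i * g ω i)) ∂μ ≤
      ENNReal.ofReal (Real.exp (s * (∑ i, t i ^ 2) / 2)))
    (c : Fin n → ℝ) (hc : ∀ i, 0 ≤ c i) {C : ℝ} (hC : 0 < C) (hcC : ∀ i, c i ≤ C) :
    μ {ω | 2 * s * (∑ i, c i) + 48 * s * C * Real.log n < ∑ i, c i * g ω i ^ 2} ≤
      ENNReal.ofReal (1 / (n : ℝ) ^ 12) := by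
  have hnR : (0 : ℝ) < n := by positivity
  -- The largest exponent that the moment bound allows; 48/4 = 12 then yields the power of `n` in
  -- Markov's inequality.
  have hη : 0 < 1 / (4 * s * C) := by positivity
  have h1 := lintegral_exp_sum_mul_sq_le μ g hg hs.le hsub (fun i => 1 / (4 * s * C) * c i)
    (fun i => mul_nonneg hη.le (hc i)) (fun i => by
      calc 4 * (s * (1 / (4 * s * C) * c i)) = c i / C := by field_simp
        _ ≤ 1 := (div_le_one hC).2 (hcC i))
  rw [← Finset.mul_sum] at h1
  set E : ℝ := 2 * s * (1 / (4 * s * C) * ∑ i, c i) with hE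
  have hmeas : Measurable fun ω =>
      ENNReal.ofReal (Real.exp (∑ i, 1 / (4 * s * C) * c i * g ω i ^ 2)) := by fun_prop
  have h2 := meas_ge_le_lintegral_div (μ := μ) hmeas.aemeasurable
    (ε := ENNReal.ofReal (Real.exp (E + 12 * Real.log n)))
    (by simpa using Real.exp_pos _) ENNReal.ofReal_ne_top
  refine (measure_mono fun ω hω => ?_).trans (h2.trans ?_)
  · simp only [Set.mem_ofPred_eq] at hω ⊢
    refine ENNReal.ofReal_le_ofReal (Real.exp_le_exp.2 ?_)
    simp_rw [mul_assoc (1 / (4 * s * C)), ← Finset.mul_sum]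
    have h3 := mul_le_mul_of_nonneg_left hω.le hη.le
    refine le_trans (le_of_eq ?_) h3
    rw [hE]
    field_simp
    ring
  · refine (ENNReal.div_le_div_right h1 _).trans (le_of_eq ?_)
    rw [← ENNReal.ofReal_div_of_pos (Real.exp_pos _), ← Real.exp_sub]
    congr 1
    rw [sub_add_cancel_left, Real.exp_neg, one_div]
    congr 1
    have := Real.exp_nat_mul (Real.log n) 12
    rw [Real.exp_log hnR] at this
    exact_mod_cast this

end Moments

end BTL

/-! ### The Hessian at the true scores -/

namespace BTL

variable {n L : ℕ}

/-- The weights of the Hessian of the loss at `θ`. -/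
noncomputable def hess (θ : Fin n → ℝ) (w : Fin n → Fin n → ℝ) (i j : Fin n) : ℝ :=
  w i j * dsig (θ i - θ j)

theorem hess_symm (θ : Fin n → ℝ) {w : Fin n → Fin n → ℝ} (hs : ∀ i j, w i j = w j i)
    (i j : Fin n) : hess θ w i j = hess θ w j i := by
  rw [hess, hess, hs, ← dsig_neg, neg_sub]

theorem hess_nonneg (θ : Fin n → ℝ) {w : Fin n → Fin n → ℝ} (h0 : ∀ i j, 0 ≤ w i j)
    (i j : Fin n) : 0 ≤ hess θ w i j :=
  mul_nonneg (h0 i j) (dsig_nonneg _)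

theorem hess_le (θ : Fin n → ℝ) {w : Fin n → Fin n → ℝ} (h0 : ∀ i j, 0 ≤ w i j)
    (i j : Fin n) : hess θ w i j ≤ w i j / 4 := by
  rw [hess, div_eq_mul_one_div]
  exact mul_le_mul_of_nonneg_left (dsig_le _) (h0 i j)

theorem condNumber_pos (hn : 2 ≤ n) (θ : Fin n → ℝ) : 0 < condNumber hn θ := by
  rw [condNumber]; positivity

/-- Score differences are at most log κ in absolute value, so the logistic derivative is at least
1/(4κ). -/
theorem le_mul_hess (hn : 2 ≤ n) {θ : Fin n → ℝ} (hθ : Antitone θ) {w : Fin n → Fin n → ℝ}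
    (h0 : ∀ i j, 0 ≤ w i j) (i j : Fin n) : w i j ≤ 4 * condNumber hn θ * hess θ w i j := by
  have h1 : ∀ i, θ i ≤ θ ⟨0, by omega⟩ := fun i => hθ (Fin.mk_le_mk.2 (Nat.zero_le _))
  have h2 : ∀ i, θ ⟨n - 1, by omega⟩ ≤ θ i := fun i => hθ (Fin.mk_le_mk.2 (by omega))
  have h3 : |θ i - θ j| ≤ θ ⟨0, by omega⟩ - θ ⟨n - 1, by omega⟩ := by
    rw [abs_le]; constructor <;> linarith [h1 i, h1 j, h2 i, h2 j]
  have h4 := exp_neg_div_four_le_dsig h3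
  have h5 : Real.exp (-(θ ⟨0, by omega⟩ - θ ⟨n - 1, by omega⟩)) = 1 / condNumber hn θ := by
    rw [condNumber, Real.exp_neg, Real.exp_sub, one_div]
  rw [h5, div_div, div_le_iff₀ (by have := condNumber_pos hn θ; positivity)] at h4
  rw [hess]
  nlinarith [mul_le_mul_of_nonneg_left h4 (h0 i j)]

theorem hasGap_hess (hn : 2 ≤ n) {θ : Fin n → ℝ} (hθ : Antitone θ) {w : Fin n → Fin n → ℝ}
    (h0 : ∀ i j, 0 ≤ w i j) {l : ℝ} (hl : HasGap w l) :
    HasGap (hess θ w) (l / (4 * condNumber hn θ)) := by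
  intro v hv
  have hκ := condNumber_pos hn θ
  have h1 := (hl v hv).trans (energy_le_mul_energy (le_mul_hess hn hθ h0) v)
  rw [div_mul_eq_mul_div, div_le_iff₀ (by positivity)]
  linarith

theorem sum_le_dMax {w : Fin n → Fin n → ℝ} (hd : ∀ i, w i i = 0) (i : Fin n) :
    ∑ j, w i j ≤ dMax w := by
  have h1 : ∑ j, w i j = wDegree w i := by
    rw [wDegree, Finset.sum_filter]
    refine Finset.sum_congr rfl fun j _ => ?_
    by_cases h : j = i
    · simp [h, hd]
    · simp [h]
  rw [h1]
  exact le_ciSup (Set.finite_range _).bddAbove i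

theorem le_wMax (w : Fin n → Fin n → ℝ) (i j : Fin n) : w i j ≤ wMax w :=
  le_ciSup (f := fun p : Fin n × Fin n => w p.1 p.2) (Set.finite_range _).bddAbove (i, j)

theorem greenFlow_le {w z : Fin n → Fin n → ℝ} (hn : 0 < n) (h0 : ∀ i j, 0 ≤ w i j) {D : ℝ}
    (hD : ∀ i, ∑ j, w i j ≤ D) (hs : ∀ i j, z i j = z j i) {l : ℝ} (hl : 0 < l)
    (hz : HasGap z l) (k i : Fin n) : greenFlow w z k i ≤ 2 * D / l := by
  have h1 : greenFlow w z k i ≤ ∑ j, w i j * (2 / l) := by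
    refine Finset.sum_le_sum fun j _ => mul_le_mul_of_nonneg_left ?_ (h0 i j)
    refine (abs_sub _ _).trans ?_
    have h2 := abs_green_le hn hs hl hz k i
    have h3 := abs_green_le hn hs hl hz k j
    have : 2 / l = 1 / l + 1 / l := by ring
    linarith
  rw [← Finset.sum_mul] at h1
  refine h1.trans ?_
  rw [mul_div_assoc', mul_comm 2]
  refine div_le_div_of_nonneg_right ?_ hl.le
  linarith [hD i]

theorem sum_greenFlow_le {w : Fin n → Fin n → ℝ} (hs : ∀ i j, w i j = w j i)
    (h0 : ∀ i j, 0 ≤ w i j) {D : ℝ} (hD : ∀ i, ∑ j, w i j ≤ D) (z : Fin n → Fin n → ℝ)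
    (k : Fin n) : ∑ i, greenFlow w z k i ≤ 2 * D * ∑ i, |green z k i| := by
  have h1 : ∑ i, greenFlow w z k i ≤
      ∑ i, ∑ j, (w i j * |green z k i| + w i j * |green z k j|) := by
    refine Finset.sum_le_sum fun i _ => Finset.sum_le_sum fun j _ => ?_
    rw [← mul_add]
    exact mul_le_mul_of_nonneg_left (abs_sub _ _) (h0 i j)
  have h2 : ∑ i, ∑ j, w i j * |green z k i| ≤ D * ∑ i, |green z k i| := by
    rw [Finset.mul_sum]
    refine Finset.sum_le_sum fun i _ => ?_
    rw [← Finset.sum_mul]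
    exact mul_le_mul_of_nonneg_right (hD i) (abs_nonneg _)
  have h3 : ∑ i, ∑ j, w i j * |green z k j| = ∑ i, ∑ j, w i j * |green z k i| := by
    rw [Finset.sum_comm]
    exact Finset.sum_congr rfl fun i _ => Finset.sum_congr rfl fun j _ => by rw [hs]
  simp_rw [Finset.sum_add_distrib] at h1
  linarith

/-! ### The good event -/

/-- The variance proxy of the linearized estimator. -/
noncomputable def proxy (hn : 2 ≤ n) (L : ℕ) (θ : Fin n → ℝ) (w : Fin n → Fin n → ℝ) : ℝ :=
  4 * condNumber hn θ ^ 2 * wMax w / (symmGap hn w * L)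

/-- The linearized estimator of the deviation of the weighted MLE from the true scores `θ`. -/
noncomputable def linEst (G : SimpleGraph (Fin n)) [DecidableRel G.Adj] (θ : Fin n → ℝ)
    (w : Fin n → Fin n → ℝ) (o : ComparisonIdx G L → Bool) (k : Fin n) : ℝ :=
  noiseSum G θ w o (green (hess θ w) k)

/-- The bound for the second order terms. -/
noncomputable def quadBound (hn : 2 ≤ n) (L : ℕ) (θ : Fin n → ℝ) (w : Fin n → Fin n → ℝ) : ℝ :=
  496 * proxy hn L θ w * (condNumber hn θ * dMax w / symmGap hn w) * Real.log n

/-- The weights and outcomes for which the linearized estimator and the second order terms are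
controlled. -/
def goodSet (hn : 2 ≤ n) (G : SimpleGraph (Fin n)) [DecidableRel G.Adj] (θ : Fin n → ℝ) :
    Set ((Fin n → Fin n → ℝ) × (ComparisonIdx G L → Bool)) :=
  {p | ∀ k, linEst G θ p.1 p.2 k ^ 2 ≤ 51 * proxy hn L θ p.1 * Real.log n ∧
    ∑ i, greenFlow p.1 (hess θ p.1) k i * linEst G θ p.1 p.2 i ^ 2 ≤ quadBound hn L θ p.1}

/-- By the adjugate formula the inverse is a quotient of continuous functions of `w`; where the
determinant vanishes, both sides use the inverse 0. -/
theorem measurable_green_hess (θ : Fin n → ℝ) (k i : Fin n) :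
    Measurable fun w : Fin n → Fin n → ℝ => green (hess θ w) k i := by
  have hc : Continuous fun w : Fin n → Fin n → ℝ => lapMatrix (hess θ w) := by
    refine continuous_matrix fun a b => ?_
    simp only [lapMatrix, Matrix.add_apply, Matrix.sub_apply, Matrix.of_apply,
      Matrix.diagonal_apply, hess]
    split_ifs <;> fun_prop
  have hd : Continuous fun w : Fin n → Fin n → ℝ => (lapMatrix (hess θ w)).det := hc.matrix_det
  have ha : Continuous fun w : Fin n → Fin n → ℝ => (lapMatrix (hess θ w)).adjugate i k :=
    hc.matrix_adjugate.matrix_elem i k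
  have : (fun w : Fin n → Fin n → ℝ => green (hess θ w) k i) = fun w =>
      ((lapMatrix (hess θ w)).det)⁻¹ * (lapMatrix (hess θ w)).adjugate i k - 1 / (n : ℝ) := by
    funext w
    rw [green, Matrix.inv_def, Matrix.smul_apply, Ring.inverse_eq_inv', smul_eq_mul]
  rw [this]
  exact (hd.measurable.inv.mul ha.measurable).sub_const _

theorem measurable_linEst (G : SimpleGraph (Fin n)) [DecidableRel G.Adj] (θ : Fin n → ℝ)
    (k : Fin n) : Measurable fun p : (Fin n → Fin n → ℝ) × (ComparisonIdx G L → Bool) =>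
      linEst G θ p.1 p.2 k := by
  unfold linEst noiseSum
  have hg : ∀ i, Measurable fun p : (Fin n → Fin n → ℝ) × (ComparisonIdx G L → Bool) =>
      green (hess θ p.1) k i := fun i => (measurable_green_hess θ k i).comp measurable_fst
  have hr : ∀ q, Measurable fun p : (Fin n → Fin n → ℝ) × (ComparisonIdx G L → Bool) =>
      winRev (p.2 q) := fun q =>
    measurable_winRev.comp ((measurable_pi_apply q).comp measurable_snd)
  have hw : ∀ i j, Measurable fun p : (Fin n → Fin n → ℝ) × (ComparisonIdx G L → Bool) =>
      p.1 i j := fun i j => by fun_prop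
  exact Finset.measurable_sum _ fun q _ =>
    (((hw _ _).div_const _).mul ((hg _).sub (hg _))).mul ((hr q).sub_const _)

theorem measurableSet_goodSet (hn : 2 ≤ n) (G : SimpleGraph (Fin n)) [DecidableRel G.Adj]
    (θ : Fin n → ℝ) : MeasurableSet (goodSet (L := L) hn G θ) := by
  have hmax : Measurable (wMax (n := n)) := by
    unfold wMax
    exact Measurable.iSup fun p => by fun_prop
  have hdeg : Measurable (dMax (n := n)) := by
    unfold dMax wDegree
    exact Measurable.iSup fun p => by fun_prop
  have hgap := measurable_symmGap (n := n) hn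
  have hproxy : Measurable (proxy hn L θ) := (hmax.const_mul _).div (hgap.mul_const _)
  have hquad : Measurable (quadBound hn L θ) :=
    ((hproxy.const_mul _).mul ((hdeg.const_mul _).div hgap)).mul_const _
  have hflow : ∀ k i, Measurable fun w : Fin n → Fin n → ℝ => greenFlow w (hess θ w) k i := by
    intro k i
    unfold greenFlow
    refine Finset.measurable_sum _ fun j _ => Measurable.mul (by fun_prop) ?_
    exact ((measurable_green_hess θ k i).sub (measurable_green_hess θ k j)).norm
  unfold goodSet
  rw [Set.ofPred_forall]
  refine MeasurableSet.iInter fun k => ?_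
  rw [Set.ofPred_and]
  refine MeasurableSet.inter ?_ ?_
  · exact measurableSet_le ((measurable_linEst G θ k).pow_const 2)
      (((hproxy.comp measurable_fst).const_mul _).mul_const _)
  · refine measurableSet_le (Finset.measurable_sum _ fun i _ => ?_) (hquad.comp measurable_fst)
    exact ((hflow k i).comp measurable_fst).mul ((measurable_linEst G θ i).pow_const 2)

/-- The weights to which the analysis applies. -/
structure IsGoodWeight (G : SimpleGraph (Fin n)) (w : Fin n → Fin n → ℝ) : Prop where
  weighting : IsWeighting G w
  connected : (supportGraph w).Connected
  one_le_dMin : 1 ≤ dMin w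

namespace IsGoodWeight

variable {G : SimpleGraph (Fin n)} {w : Fin n → Fin n → ℝ}

theorem diag (hw : IsGoodWeight G w) (i : Fin n) : w i i = 0 :=
  hw.weighting.supported i i (G.irrefl)

theorem gap_pos (hw : IsGoodWeight G w) (hn : 2 ≤ n) : 0 < spectralGap hn w :=
  spectralGap_pos hn hw.weighting.symm hw.weighting.nonneg hw.connected

theorem symmGap_eq (hw : IsGoodWeight G w) (hn : 2 ≤ n) : symmGap hn w = spectralGap hn w := by
  rw [symmGap, if_pos ⟨hw.weighting.symm, hw.weighting.nonneg⟩]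

theorem dMax_pos (hw : IsGoodWeight G w) (hn : 2 ≤ n) : 0 < dMax w := by
  have h1 : dMin w ≤ wDegree w ⟨0, by omega⟩ := ciInf_le (Set.finite_range _).bddBelow _
  have h2 : wDegree w ⟨0, by omega⟩ ≤ dMax w :=
    le_ciSup (Set.finite_range (wDegree w)).bddAbove _
  linarith [hw.one_le_dMin]

theorem gap_le (hw : IsGoodWeight G w) (hn : 2 ≤ n) : spectralGap hn w ≤ 2 * dMax w :=
  gap_le_of_degree_le hn hw.weighting.symm hw.weighting.nonneg (sum_le_dMax hw.diag)
    (hasGap_spectralGap hn hw.weighting.symm hw.weighting.nonneg)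

theorem wMax_pos (hw : IsGoodWeight G w) (hn : 2 ≤ n) : 0 < wMax w := by
  by_contra h
  have h1 : ∀ i j, w i j = 0 := fun i j =>
    le_antisymm ((le_wMax w i j).trans (not_lt.1 h)) (hw.weighting.nonneg i j)
  have h2 : dMax w = 0 := by
    have : Nonempty (Fin n) := ⟨⟨0, by omega⟩⟩
    simp [dMax, wDegree, h1]
  exact (hw.dMax_pos hn).ne' h2

variable {θ : Fin n → ℝ}

theorem hasGap_hess (hw : IsGoodWeight G w) (hn : 2 ≤ n) (hθ : Antitone θ) :
    HasGap (hess θ w) (spectralGap hn w / (4 * condNumber hn θ)) :=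
  BTL.hasGap_hess hn hθ hw.weighting.nonneg
    (hasGap_spectralGap hn hw.weighting.symm hw.weighting.nonneg)

theorem hess_gap_pos (hw : IsGoodWeight G w) (hn : 2 ≤ n) (θ : Fin n → ℝ) :
    0 < spectralGap hn w / (4 * condNumber hn θ) := by
  have h1 := hw.gap_pos hn
  have h2 := condNumber_pos hn θ
  positivity

theorem greenFlow_le (hw : IsGoodWeight G w) (hn : 2 ≤ n) (hθ : Antitone θ) (k i : Fin n) :
    greenFlow w (hess θ w) k i ≤ 8 * (condNumber hn θ * dMax w / spectralGap hn w) := by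
  have := BTL.greenFlow_le (by omega) hw.weighting.nonneg (sum_le_dMax hw.diag)
    (hess_symm θ hw.weighting.symm) (hw.hess_gap_pos hn θ) (hw.hasGap_hess hn hθ) k i
  refine this.trans (le_of_eq ?_)
  have h1 := hw.gap_pos hn
  have h2 := condNumber_pos hn θ
  field_simp
  ring

theorem sum_greenFlow_le (hw : IsGoodWeight G w) (hn : 2 ≤ n) (hθ : Antitone θ) (k : Fin n) :
    ∑ i, greenFlow w (hess θ w) k i ≤
      56 * (condNumber hn θ * dMax w / spectralGap hn w) * Real.log n := by
  have hd := hw.dMax_pos hn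
  have h1 := BTL.sum_greenFlow_le hw.weighting.symm hw.weighting.nonneg (sum_le_dMax hw.diag)
    (hess θ w) k
  have h2 := sum_abs_green_le hn (hess_symm θ hw.weighting.symm) (hess_nonneg θ hw.weighting.nonneg)
    hd (fun i => by
      have h3 : ∑ j, hess θ w i j ≤ ∑ j, w i j / 4 :=
        Finset.sum_le_sum fun j _ => hess_le θ hw.weighting.nonneg i j
      rw [← Finset.sum_div] at h3
      linarith [sum_le_dMax hw.diag i]) (hw.hess_gap_pos hn θ) (hw.hasGap_hess hn hθ) k
  refine h1.trans ((mul_le_mul_of_nonneg_left h2 (by positivity)).trans (le_of_eq ?_))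
  have h1 := hw.gap_pos hn
  have h2 := condNumber_pos hn θ
  field_simp
  ring

theorem proxy_pos (hw : IsGoodWeight G w) (hn : 2 ≤ n) (hL : 0 < L) (θ : Fin n → ℝ) :
    0 < proxy hn L θ w := by
  have h1 := hw.gap_pos hn
  have h2 := condNumber_pos hn θ
  have h3 := hw.wMax_pos hn
  rw [proxy, hw.symmGap_eq]
  positivity

/-- A linear combination of the estimates is the noise paired with `u`, the Poisson solution with
source `t`. One factor 4κ comes from comparing the energies of `w` and of the Hessian, another from
the Hessian gap. -/
theorem lintegral_exp_linEst_le {Ω : Type*} [MeasurableSpace Ω] {μ : Measure Ω}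
    [IsProbabilityMeasure μ] {y : Fin n → Fin n → Fin L → Ω → Bool} [DecidableRel G.Adj]
    (hw : IsGoodWeight G w) (hn : 2 ≤ n) (hL : 0 < L) (hθ : Antitone θ) (hy : IsBTLSample μ G θ y)
    (t : Fin n → ℝ) :
    ∫⁻ ω, ENNReal.ofReal (Real.exp (∑ k, t k * linEst G θ w (observed G y ω) k)) ∂μ ≤
      ENNReal.ofReal (Real.exp (proxy hn L θ w * (∑ i, t i ^ 2) / 2)) := by
  have hn0 : 0 < n := by omega
  have hsz := hess_symm θ hw.weighting.symm
  have hl := hw.hess_gap_pos hn θ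
  have hz := hw.hasGap_hess hn hθ
  have hκ := condNumber_pos hn θ
  have hg := hw.gap_pos hn
  have hM := hw.wMax_pos hn
  let u : Fin n → ℝ := fun i => ∑ k, t k * green (hess θ w) k i
  have h1 : ∀ o : ComparisonIdx G L → Bool, ∑ k, t k * linEst G θ w o k = noiseSum G θ w o u := by
    intro o
    simp only [linEst, noiseSum, Finset.mul_sum]
    rw [Finset.sum_comm]
    refine Finset.sum_congr rfl fun q _ => ?_
    simp only [u]
    rw [← Finset.sum_sub_distrib, Finset.mul_sum, Finset.sum_mul]
    exact Finset.sum_congr rfl fun k _ => by ring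
  have hu : ∑ i, u i = 0 := by
    simp only [u]
    rw [Finset.sum_comm]
    refine Finset.sum_eq_zero fun k _ => ?_
    rw [← Finset.mul_sum, sum_green' hn0 hsz hl hz, mul_zero]
  have hlap : ∀ i, lap (hess θ w) u i = t i - (∑ k, t k) / n := by
    intro i
    have h2 : lap (hess θ w) u i = ∑ k, t k * lap (hess θ w) (green (hess θ w) k) i := by
      simp only [lap, u, Finset.mul_sum]
      rw [Finset.sum_comm]
      refine Finset.sum_congr rfl fun j _ => ?_
      rw [← Finset.sum_sub_distrib, Finset.mul_sum]
      exact Finset.sum_congr rfl fun k _ => by ring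
    rw [h2]
    simp_rw [lap_green hn0 hsz hl hz, mul_sub, Finset.sum_sub_distrib]
    simp [Finset.sum_mul, div_eq_mul_inv]
  have hE : energy w u ≤ 16 * condNumber hn θ ^ 2 / spectralGap hn w * ∑ i, t i ^ 2 := by
    have h3 := energy_le_mul_energy (le_mul_hess hn hθ hw.weighting.nonneg) u
    have h4 := energy_le_of_lap_eq hsz hl hz hu hlap
    refine h3.trans ((mul_le_mul_of_nonneg_left h4 (by positivity)).trans (le_of_eq ?_))
    field_simp
    ring
  simp_rw [h1]
  refine (lintegral_exp_noiseSum_le hy hL hw.weighting.symm hw.weighting.nonneg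
    hw.weighting.supported (le_wMax w) u).trans ?_
  refine ENNReal.ofReal_le_ofReal (Real.exp_le_exp.2 (div_le_div_of_nonneg_right ?_ two_pos.le))
  rw [proxy, hw.symmGap_eq]
  have hLR : (0 : ℝ) < L := by exact_mod_cast hL
  calc wMax w * energy w u / (4 * L)
      ≤ wMax w * (16 * condNumber hn θ ^ 2 / spectralGap hn w * ∑ i, t i ^ 2) / (4 * L) := by
        gcongr
    _ = _ := by field_simp; ring

theorem measure_not_goodSet_le {Ω : Type*} [MeasurableSpace Ω] {μ : Measure Ω}
    [IsProbabilityMeasure μ] {y : Fin n → Fin n → Fin L → Ω → Bool} [DecidableRel G.Adj]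
    (hw : IsGoodWeight G w) (hn : 2 ≤ n) (hL : 0 < L) (hθ : Antitone θ)
    (hy : IsBTLSample μ G θ y) :
    μ {ω | (w, observed G y ω) ∉ goodSet hn G θ} ≤ ENNReal.ofReal (1 / (n : ℝ) ^ 10) := by
  have hn2 : (2 : ℝ) ≤ n := by exact_mod_cast hn
  have hnR : (0 : ℝ) < n := by linarith
  have hlog : 0.69 ≤ Real.log n := by
    have h2 : Real.log 2 ≤ Real.log n := Real.log_le_log two_pos hn2
    linarith [Real.log_two_gt_d9]
  set s := proxy hn L θ w with hsdef
  have hs : 0 < s := hw.proxy_pos hn hL θ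
  set B := condNumber hn θ * dMax w / spectralGap hn w with hB
  have hBpos : 0 < B := by
    have h1 := hw.gap_pos hn
    have h2 := condNumber_pos hn θ
    have h3 := hw.dMax_pos hn
    positivity
  let g : Ω → Fin n → ℝ := fun ω => linEst G θ w (observed G y ω)
  have hg : Measurable g := measurable_pi_lambda _ fun k =>
    (measurable_linEst G θ k).comp (measurable_const.prodMk (measurable_observed hy))
  have hsub := hw.lintegral_exp_linEst_le hn hL hθ hy
  have b1 : ∀ k, μ {ω | 51 * s * Real.log n < g ω k ^ 2} ≤ ENNReal.ofReal (1 / (n : ℝ) ^ 12) := by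
    intro k
    have h1 := measure_sum_mul_sq_gt_le hn g hg hs hsub (fun i => if i = k then 1 else 0)
      (fun i => by split_ifs <;> norm_num) one_pos (fun i => by split_ifs <;> norm_num)
    refine (measure_mono fun ω hω => ?_).trans h1
    simp only [Set.mem_ofPred_eq] at hω ⊢
    simp only [ite_mul, one_mul, zero_mul, Finset.sum_ite_eq', Finset.mem_univ, if_true]
    nlinarith
  have b2 : ∀ k, μ {ω | quadBound hn L θ w < ∑ i, greenFlow w (hess θ w) k i * g ω i ^ 2} ≤
      ENNReal.ofReal (1 / (n : ℝ) ^ 12) := by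
    intro k
    have h1 := measure_sum_mul_sq_gt_le hn g hg hs hsub (greenFlow w (hess θ w) k)
      (greenFlow_nonneg hw.weighting.nonneg _ k) (C := 8 * B) (by positivity)
      (hw.greenFlow_le hn hθ k)
    refine (measure_mono fun ω hω => ?_).trans h1
    simp only [Set.mem_ofPred_eq] at hω ⊢
    refine lt_of_le_of_lt ?_ hω
    have h2 := mul_le_mul_of_nonneg_left (hw.sum_greenFlow_le hn hθ k)
      (by positivity : 0 ≤ 2 * s)
    -- 496 = 2 * 56 + 48 * 8: the sum of the coefficients and their maximum contribute at the same
    -- order.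
    rw [quadBound, hw.symmGap_eq, ← hB, ← hsdef]
    rw [← hB] at h2
    linarith
  have hsubset : {ω | (w, observed G y ω) ∉ goodSet hn G θ} ⊆
      ⋃ k, ({ω | 51 * s * Real.log n < g ω k ^ 2} ∪
        {ω | quadBound hn L θ w < ∑ i, greenFlow w (hess θ w) k i * g ω i ^ 2}) := by
    intro ω hω
    simp only [goodSet, Set.mem_ofPred_eq, not_forall, not_and_or, not_le] at hω
    obtain ⟨k, hk⟩ := hω
    exact Set.mem_iUnion.2 ⟨k, hk⟩
  refine (measure_mono hsubset).trans ((measure_iUnion_fintype_le μ _).trans ?_)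
  refine (Finset.sum_le_sum fun k _ => (measure_union_le _ _).trans
    (add_le_add (b1 k) (b2 k))).trans ?_
  rw [Finset.sum_const, Finset.card_univ, Fintype.card_fin, nsmul_eq_mul,
    ← ENNReal.ofReal_add (by positivity) (by positivity), ← ENNReal.ofReal_natCast,
    ← ENNReal.ofReal_mul hnR.le]
  refine ENNReal.ofReal_le_ofReal ?_
  -- The union is over 2n events, and 2n · n⁻¹² ≤ n⁻¹⁰ with room to spare.
  have h3 : (n : ℝ) * (1 / (n : ℝ) ^ 12 + 1 / (n : ℝ) ^ 12) = (2 / n) * (1 / (n : ℝ) ^ 10) := by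
    field_simp
    ring
  rw [h3]
  refine mul_le_of_le_one_left (by positivity) ((div_le_one hnR).2 hn2)

end IsGoodWeight

end BTL

/-! ### The weighted maximum likelihood estimator on the good event -/

namespace BTL

variable {n L : ℕ}

theorem recoversTop_of_abs_sub_le {θ θs : Fin n → ℝ} (hθs : Antitone θs) {K : ℕ} (hK : K < n)
    (hK1 : 1 ≤ K) {ε : ℝ} (hε : ∀ k, |θ k - θs k| ≤ ε) (hgap : 2 * ε < scoreGap θs K hK) :
    RecoversTop θ K := by
  have key : ∀ i j : Fin n, (i : ℕ) < K → K ≤ (j : ℕ) → θ j < θ i := by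
    intro i j hi hj
    have h1 : θs ⟨K - 1, by omega⟩ ≤ θs i := hθs (Fin.le_def.2 (by simp; omega))
    have h2 : θs j ≤ θs ⟨K, hK⟩ := hθs (Fin.le_def.2 hj)
    have h3 := abs_le.1 (hε i)
    have h4 := abs_le.1 (hε j)
    rw [scoreGap] at hgap
    linarith
  have hcard : (Finset.univ.filter (fun i : Fin n => (i : ℕ) < K)).card = K := by
    rw [Fin.card_filter_val_lt]; omega
  intro S
  constructor
  · rintro ⟨hS, hsel⟩
    refine Finset.eq_of_subset_of_card_le (fun i hi => ?_) (by rw [hcard, hS])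
    by_contra hiT
    have h1 : ∃ j ∈ Finset.univ.filter (fun i : Fin n => (i : ℕ) < K), j ∉ S := by
      by_contra! hsub
      have := Finset.eq_of_subset_of_card_le hsub (by rw [hcard, hS])
      exact hiT (this ▸ hi)
    obtain ⟨j, hj, hjS⟩ := h1
    simp only [Finset.mem_filter, Finset.mem_univ, true_and, not_lt] at hj hiT
    exact absurd (hsel i hi j hjS) (not_le.2 (key j i hj hiT))
  · rintro rfl
    refine ⟨hcard, fun i hi j hj => ?_⟩
    simp only [Finset.mem_filter, Finset.mem_univ, true_and, not_lt] at hi hj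
    exact (key i j hi hj).le

/-- The sample size condition. -/
def SampleSize (hn : 2 ≤ n) (L : ℕ) (θ : Fin n → ℝ) (w : Fin n → Fin n → ℝ) : Prop :=
  20000000 * (condNumber hn θ ^ 4 * wMax w * dMax w ^ 4 * Real.log n ^ 2 / spectralGap hn w ^ 5) ≤
    (L : ℝ)

namespace IsGoodWeight

variable {G : SimpleGraph (Fin n)} {w : Fin n → Fin n → ℝ} {θs : Fin n → ℝ}

theorem pos_of_sampleSize (hw : IsGoodWeight G w) (hn : 2 ≤ n) (hS : SampleSize hn L θs w) :
    0 < L := by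
  have h1 := hw.gap_pos hn
  have h2 := condNumber_pos hn θs
  have h3 := hw.wMax_pos hn
  have h4 := hw.dMax_pos hn
  have h5 : 0 < Real.log n := Real.log_pos (by exact_mod_cast hn)
  have h6 : (0 : ℝ) < L := lt_of_lt_of_le (by positivity) hS
  exact_mod_cast h6

/-- The analysis only needs this smaller power of D/λ; λ ≤ 2D costs the factor 4. -/
theorem sampleSize_ratio_le (hw : IsGoodWeight G w) (hn : 2 ≤ n) (hS : SampleSize hn L θs w) :
    condNumber hn θs ^ 4 * wMax w * dMax w ^ 2 * Real.log n ^ 2 / (spectralGap hn w ^ 3 * L) ≤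
      1 / 5000000 := by
  have h1 := hw.gap_pos hn
  have h2 := condNumber_pos hn θs
  have h3 := hw.wMax_pos hn
  have h4 := hw.dMax_pos hn
  have h5 : 0 < Real.log n := Real.log_pos (by exact_mod_cast hn)
  have hL : (0 : ℝ) < L := by exact_mod_cast hw.pos_of_sampleSize hn hS
  have h6 := hw.gap_le hn
  rw [SampleSize] at hS
  have h7 : 1 ≤ 4 * dMax w ^ 2 / spectralGap hn w ^ 2 := by
    rw [one_le_div (by positivity)]
    nlinarith
  have h8 : condNumber hn θs ^ 4 * wMax w * dMax w ^ 2 * Real.log n ^ 2 / spectralGap hn w ^ 3 ≤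
      4 * (condNumber hn θs ^ 4 * wMax w * dMax w ^ 4 * Real.log n ^ 2 / spectralGap hn w ^ 5) := by
    refine (le_mul_of_one_le_right (by positivity) h7).trans (le_of_eq ?_)
    field_simp
  rw [← div_div, div_le_iff₀ hL]
  linarith

theorem exists_isCritical_of_mem_goodSet {Ω : Type*} {y : Fin n → Fin n → Fin L → Ω → Bool}
    [DecidableRel G.Adj] (hw : IsGoodWeight G w) (hn : 2 ≤ n) (hθ : Antitone θs)
    (hsum : ∑ i, θs i = 0) (hS : SampleSize hn L θs w) {ω : Ω}
    (hgood : (w, observed G y ω) ∈ goodSet hn G θs) :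
    ∃ θ : Fin n → ℝ, ∑ i, θ i = 0 ∧ IsCritical w (winFreq fun i j l => y i j l ω) θ ∧
      ‖θ - θs‖ ≤ 17 * condNumber hn θs *
        Real.sqrt (wMax w * Real.log n / (spectralGap hn w * L)) := by
  have hn2 : (2 : ℝ) ≤ n := by exact_mod_cast hn
  have hlog : 0.69 ≤ Real.log n := by
    have h2 : Real.log 2 ≤ Real.log n := Real.log_le_log two_pos hn2
    linarith [Real.log_two_gt_d9]
  have hlog0 : 0 < Real.log n := by linarith
  have h1 := hw.gap_pos hn
  have h2 := condNumber_pos hn θs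
  have h3 := hw.wMax_pos hn
  have h4 := hw.dMax_pos hn
  have hLn := hw.pos_of_sampleSize hn hS
  have hL : (0 : ℝ) < L := by exact_mod_cast hLn
  have hX := hw.sampleSize_ratio_le hn hS
  set κ := condNumber hn θs
  set W := wMax w
  set D := dMax w
  set lam := spectralGap hn w with hlam
  set X := κ ^ 4 * W * D ^ 2 * Real.log n ^ 2 / (lam ^ 3 * L) with hXdef
  set r := W * Real.log n / (lam * L) with hr
  have hrpos : 0 < r := by positivity
  have hproxy : proxy hn L θs w = 4 * κ ^ 2 * W / (lam * L) := by rw [proxy, hw.symmGap_eq]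
  have hQ : quadBound hn L θs w = 1984 * κ ^ 3 * W * D * Real.log n / (lam ^ 2 * L) := by
    rw [quadBound, hproxy, hw.symmGap_eq]
    change 496 * (4 * κ ^ 2 * W / (lam * L)) * (κ * D / lam) * Real.log n = _
    field_simp
    ring
  have hQ0 : 0 ≤ quadBound hn L θs w := by rw [hQ]; positivity
  -- 28 is half of the 56 in `sum_greenFlow_le`, and 28 * 1984 = 55552.
  have hSQ : 28 * (κ * D / lam) * Real.log n * quadBound hn L θs w ≤ 1 / 50 := by
    have : 28 * (κ * D / lam) * Real.log n * quadBound hn L θs w = 55552 * X := by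
      rw [hQ, hXdef]; field_simp; ring
    rw [this]
    linarith
  -- The second order bound squared is κ²r times a multiple of X / log n, so small X puts it below
  -- the target rate.
  have hQr : quadBound hn L θs w ≤ 2 * κ * Real.sqrt r := by
    refine le_of_abs_le (abs_le_of_sq_le_sq ?_ (by positivity))
    rw [mul_pow, Real.sq_sqrt hrpos.le]
    have h5 : quadBound hn L θs w ^ 2 = (κ ^ 2 * r) * (1984 ^ 2 * (X / Real.log n)) := by
      rw [hQ, hXdef, hr]; field_simp
    have h6 : X / Real.log n ≤ 1 / 3450000 := by
      rw [div_le_iff₀ hlog0]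
      linarith
    rw [h5]
    have h7 : 0 < κ ^ 2 * r := by positivity
    nlinarith
  obtain ⟨θ, hθ1, hθ2, hθ3⟩ := exists_isCritical (z := hess θs w) (by omega) hw.weighting.symm
    hw.weighting.nonneg θs (fun i j => rfl) (hw.hess_gap_pos hn θs) (hw.hasGap_hess hn hθ)
    (winFreq fun i j l => y i j l ω) (g := linEst G θs w (observed G y ω))
    (fun k => noiseSum_observed G hLn θs hw.weighting.supported y ω _ k)
    (S := 28 * (κ * D / lam) * Real.log n) (Q := quadBound hn L θs w) hQ0
    (fun k => (hw.sum_greenFlow_le hn hθ k).trans (le_of_eq (by ring)))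
    (fun k => (hgood k).2) hSQ
  refine ⟨θ, by rw [hθ1, hsum], hθ2, ?_⟩
  rw [pi_norm_le_iff_of_nonneg (by positivity)]
  intro k
  rw [Pi.sub_apply, Real.norm_eq_abs]
  refine (hθ3 k).trans ?_
  have h5 : |linEst G θs w (observed G y ω) k| ≤ 15 * κ * Real.sqrt r := by
    refine abs_le_of_sq_le_sq ((hgood k).1.trans ?_) (by positivity)
    rw [mul_pow, Real.sq_sqrt hrpos.le]
    change 51 * proxy hn L θs w * Real.log n ≤ _
    have h6 : 51 * proxy hn L θs w * Real.log n = 204 * (κ ^ 2 * r) := by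
      rw [hproxy, hr]; field_simp; ring
    have h7 : 0 < κ ^ 2 * r := by positivity
    rw [h6]
    linarith
  linarith

end IsGoodWeight

/-- Independence makes the joint law a product, so a bound valid for almost every frozen value of
`f` integrates to the same bound. -/
theorem measure_prodMk_mem_le {Ω α β : Type*} [MeasurableSpace Ω] [MeasurableSpace α]
    [MeasurableSpace β] {μ : Measure Ω} [IsProbabilityMeasure μ] {f : Ω → α} {g : Ω → β}
    (hf : Measurable f) (hg : Measurable g) (hfg : IndepFun f g μ) {s : Set (α × β)}
    (hs : MeasurableSet s) {c : ENNReal} (hc : ∀ᵐ ω' ∂μ, μ {ω | (f ω', g ω) ∈ s} ≤ c) :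
    μ {ω | (f ω, g ω) ∈ s} ≤ c := by
  have := Measure.isProbabilityMeasure_map (μ := μ) hg.aemeasurable
  have := Measure.isProbabilityMeasure_map (μ := μ) hf.aemeasurable
  have h1 := (indepFun_iff_map_prod_eq_prod_map_map hf.aemeasurable hg.aemeasurable).1 hfg
  have h2 : μ {ω | (f ω, g ω) ∈ s} = (μ.map fun ω => (f ω, g ω)) s :=
    (Measure.map_apply (hf.prodMk hg) hs).symm
  rw [h2, h1, Measure.prod_apply hs, lintegral_map (measurable_measure_prodMk_left hs) hf]
  calc ∫⁻ ω', μ.map g (Prod.mk (f ω') ⁻¹' s) ∂μ ≤ ∫⁻ _, c ∂μ := by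
        refine lintegral_mono_ae (hc.mono fun ω' h => ?_)
        rw [Measure.map_apply hg (measurable_prodMk_left hs)]
        exact h
    _ = c := by simp

end BTL

/-! ### The main theorem -/

theorem mainTheorem2 :
    ∃ C₁ C₂ C₃ : ℝ, 0 < C₁ ∧ 0 < C₂ ∧ 0 < C₃ ∧
      ∀ (n : ℕ) (hn : 2 ≤ n) (L : ℕ) (θs : Fin n → ℝ), Antitone θs → ∑ i, θs i = 0 →
      ∀ (G : SimpleGraph (Fin n))
        (Ω : Type*) [MeasurableSpace Ω] (μ : Measure Ω) [IsProbabilityMeasure μ]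
        (y : Fin n → Fin n → Fin L → Ω → Bool) (w : Ω → Fin n → Fin n → ℝ),
      IsBTLSample μ G θs y →
      Measurable w →
      IndepFun w (observed G y) μ →
      (∀ᵐ ω ∂μ, IsWeighting G (w ω) ∧ (supportGraph (w ω)).Connected ∧
        wMax (w ω) ≤ (n : ℝ) ^ 2 ∧ 1 ≤ dMin (w ω) ∧
        C₁ * (condNumber hn θs ^ 4 * wMax (w ω) * dMax (w ω) ^ 4 * Real.log n ^ 2 /
          spectralGap hn (w ω) ^ 5) ≤ (L : ℝ)) →
      ∃ A : Set Ω, MeasurableSet A ∧ 1 - 1 / (n : ℝ) ^ 10 ≤ μ.real A ∧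
        ∀ ω ∈ A,
          (∃! θ, IsWeightedMLE (w ω) (fun i j l => y i j l ω) θ) ∧
          ∀ θ, IsWeightedMLE (w ω) (fun i j l => y i j l ω) θ →
            ‖θ - θs‖ ≤ C₂ * condNumber hn θs *
              Real.sqrt (wMax (w ω) * Real.log n / (spectralGap hn (w ω) * L)) ∧
            ∀ (K : ℕ) (hK : K < n), 1 ≤ K → 0 < scoreGap θs K hK →
              C₃ * (condNumber hn θs ^ 2 * wMax (w ω) * Real.log n /
                (spectralGap hn (w ω) * scoreGap θs K hK ^ 2)) ≤ (L : ℝ) →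
              RecoversTop θ K := by
  classical
  -- The first constant is that of `SampleSize`; 17 = 15 + 2 adds the linear and second order
  -- errors; 3000 exceeds (2 * 17)² = 1156, so twice the error stays strictly below the score gap.
  refine ⟨20000000, 17, 3000, by norm_num, by norm_num, by norm_num, ?_⟩
  intro n hn L θs hθ hsum G Ω _ μ _ y w hy hwm hind hae
  have hae' : ∀ᵐ ω ∂μ, BTL.IsGoodWeight G (w ω) ∧ BTL.SampleSize hn L θs (w ω) :=
    hae.mono fun ω h => ⟨⟨h.1, h.2.1, h.2.2.2.1⟩, h.2.2.2.2⟩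
  have hobs := BTL.measurable_observed hy
  have hgs := BTL.measurableSet_goodSet (L := L) hn G θs
  have hbad : μ {ω | (w ω, observed G y ω) ∈ (BTL.goodSet hn G θs)ᶜ} ≤
      ENNReal.ofReal (1 / (n : ℝ) ^ 10) :=
    BTL.measure_prodMk_mem_le hwm hobs hind hgs.compl (hae'.mono fun ω' h =>
      h.1.measure_not_goodSet_le hn (h.1.pos_of_sampleSize hn h.2) hθ hy)
  -- The set where the weight conditions fail is null but perhaps not measurable; enlarging it keeps
  -- the final event measurable.
  obtain ⟨N, hN1, hN2, hN3⟩ := exists_measurable_superset_of_null (ae_iff.1 hae')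
  have hGm : MeasurableSet {ω | (w ω, observed G y ω) ∈ BTL.goodSet hn G θs} :=
    (hwm.prodMk hobs) hgs
  refine ⟨{ω | (w ω, observed G y ω) ∈ BTL.goodSet hn G θs} ∩ Nᶜ, hGm.inter hN2.compl, ?_, ?_⟩
  · have h1 : μ.real ({ω | (w ω, observed G y ω) ∈ BTL.goodSet hn G θs} ∩ Nᶜ)ᶜ ≤
        1 / (n : ℝ) ^ 10 := by
      rw [Set.compl_inter, compl_compl]
      refine ENNReal.toReal_le_of_le_ofReal (by positivity) ((measure_union_le _ _).trans ?_)
      rw [hN3, add_zero]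
      exact hbad
    rw [probReal_compl_eq_one_sub (hGm.inter hN2.compl)] at h1
    linarith
  · rintro ω ⟨hω1, hω2⟩
    have hω3 : BTL.IsGoodWeight G (w ω) ∧ BTL.SampleSize hn L θs (w ω) := by
      by_contra h
      exact hω2 (hN1 h)
    obtain ⟨hw, hS⟩ := hω3
    have hLn := hw.pos_of_sampleSize hn hS
    obtain ⟨θ, h1, h2, h3⟩ := hw.exists_isCritical_of_mem_goodSet hn hθ hsum hS hω1
    have huniq : ∀ θ', IsWeightedMLE (w ω) (fun i j l => y i j l ω) θ' → θ' = θ := fun θ' h =>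
      BTL.eq_of_isWeightedMLE (by omega) hLn hw.weighting.symm hw.weighting.nonneg hw.connected
        h1 h2 h
    refine ⟨⟨θ, BTL.isWeightedMLE_of_isCritical hLn hw.weighting.nonneg h1 h2, huniq⟩, ?_⟩
    intro θ' hθ'
    rw [huniq θ' hθ']
    refine ⟨h3, fun K hK hK1 hΔ hLK => ?_⟩
    refine BTL.recoversTop_of_abs_sub_le hθ hK hK1
      (fun k => (norm_le_pi_norm (θ - θs) k).trans h3) ?_
    have p1 := hw.gap_pos hn
    have p2 := BTL.condNumber_pos hn θs
    have p3 := hw.wMax_pos hn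
    have p5 : 0 < Real.log n := Real.log_pos (by exact_mod_cast hn)
    have hL : (0 : ℝ) < L := by exact_mod_cast hLn
    set κ := condNumber hn θs
    set Δ := scoreGap θs K hK
    have hr : 0 ≤ wMax (w ω) * Real.log n / (spectralGap hn (w ω) * L) := by positivity
    have h5 : 3000 * (κ ^ 2 * (wMax (w ω) * Real.log n / (spectralGap hn (w ω) * L))) ≤ Δ ^ 2 := by
      rw [mul_div_assoc', div_le_iff₀ (by positivity)] at hLK
      rw [mul_div_assoc', mul_div_assoc', div_le_iff₀ (by positivity)]
      linarith
    have h6 : 2 * (17 * κ * Real.sqrt (wMax (w ω) * Real.log n / (spectralGap hn (w ω) * L))) ≤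
        Real.sqrt (1156 / 3000) * Δ := by
      refine le_of_abs_le (abs_le_of_sq_le_sq ?_ (by positivity))
      rw [mul_pow, mul_pow, mul_pow, mul_pow, Real.sq_sqrt hr, Real.sq_sqrt (by norm_num)]
      linarith
    refine lt_of_le_of_lt h6 (mul_lt_of_lt_one_left hΔ ?_)
    rw [Real.sqrt_lt' one_pos]
    norm_num
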